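/- Let $(X,\tau)$ be an uncountable Polish space and let $1\le\xi<\omega_1$. Conventions. Let $\Sigma^0_\eta(\tau),\Pi^0_\eta(\tau)$ denote the additive and multiplicative Borel classes of $(X,\tau)$. A function $f:X\to\mathbb R$ is of Baire class $0$ if it is continuous, and of Baire class $\eta>0$ if it is the pointwise limit of functions $f_n$ of Baire classes $\eta_n<\eta$. For ordinals write $\theta\lesssim\theta'$ if, for every $1\le\eta<\omega_1$, $\theta'\le\omega^\eta$ implies $\theta\le\omega^\eta$ (ordinal exponentiation), and $\theta\approx\theta'$ if $\theta\lesssim\theta'$ and $\theta'\lesssim\theta$. A derivative $D$ on the closed subsets of a topological space $X$ is iterated by $D^0(X)=X$, $D^{\eta+1}(X)=D(D^\eta(X))$, $D^\eta(X)=\bigcap_{\theta<\eta}D^\theta(X)$ for limit $\eta$; its rank $\mathrm{rk}(D)$ is the least $\eta$ with $D^\eta(X)=\emptyset$, and $\omega_1$ if there is no such $\eta$. For a Polish topology $\tau'$ on $X$ and a function $f$ of Baire class $1$ with respect to $\tau'$ define, all topological notions being taken in $\tau'$: * $\alpha_{\tau'}(f)=\sup_{p<q,\ p,q\in\mathbb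 Q}\mathrm{rk}(D_{\{f\le p\},\{f\ge q\}})$, where $D_{A,B}(F)=\overline{F\cap A}\cap\overline{F\cap B}$; * $\beta_{\tau'}(f)=\sup_{\varepsilon>0}\mathrm{rk}(D_{f,\varepsilon})$, where $D_{f,\varepsilon}(F)=\{x\in F:\omega(f,x,F)\ge\varepsilon\}$ and $\omega(f,x,F)=\inf_{U\ni x\text{ open}}\ \sup_{x_1,x_2\in U\cap F}|f(x_1)-f(x_2)|$; * $\gamma_{\tau'}(f)=\min\sup_{\varepsilon>0}\mathrm{rk}(D_{(f_n),\varepsilon})$, the minimum being over all sequences $(f_n)$ of continuous functions converging pointwise to $f$, where $D_{(f_n),\varepsilon}(F)=\{x\in F:\omega((f_n),x,F)\ge\varepsilon\}$ and $\omega((f_n),x,F)=\inf_{U\ni x\text{ open}}\ \inf_{N}\ \sup\{|f_m(y)-f_n(y)|:m,n\ge N,\ y\in U\cap F\}$. For $f$ of Baire class $\xi$ (with respect to $\tau$) let $T_{f,\xi}$ be the set of Polish topologies $\tau'\supseteq\tau$ on $X$ such that $\tau'\subseteq\Sigma^0_\xi(\tau)$ and $f$ is of Baire class $1$ with respect to $\tau'$,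 and for $\rho\in\{\alpha,\beta,\gamma\}$ put $\rho^*_\xi(f)=\min_{\tau'\in T_{f,\xi}}\rho_{\tau'}(f)$. Finally let $\alpha_\xi(f)=\sup_{p<q,\ p,q\in\mathbb Q}\alpha_\xi(\{f\le p\},\{f\ge q\})$, where $\alpha_\xi(A,B)$ is the least ordinal $\lambda$ for which there are a decreasing sequence $(F_\eta)_{\eta<\lambda}$ of $\Pi^0_\xi(\tau)$ sets with $F_0=X$, $F_\eta=\bigcap_{\theta<\eta}F_\theta$ for limit $\eta<\lambda$, and $\bigcap_{\eta<\lambda}F_\eta=\emptyset$ if $\lambda$ is a limit, such that, with $F_\lambda=\emptyset$, the set $H=\bigcup_{\eta<\lambda,\ \eta\text{ even}}(F_\eta\setminus F_{\eta+1})$ satisfies $A\subseteq H\subseteq X\setminus B$. Statement. For every bounded function $f:X\to\mathbb R$ of Baire class $\xi$, the set $T_{f,\xi}$ is non-empty, the ordinals $\alpha^*_\xi(f)$, $\beta^*_\xi(f)$, $\gamma^*_\xi(f)$ and $\alpha_\xi(f)$ are countable, and $$\alpha^*_\xi(f)\approx\beta^*_\xi(f)\approx\gamma^*_\xi(f).$$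 Moreover each of $\alpha^*_\xi(f)$, $\beta^*_\xi(f)$, $\gamma^*_\xi(f)$ is $\approx\alpha_\xi(f)$. -/

import Mathlib

open Set Filter Topology

namespace BaireRank

/-- `SigmaZero τ ξ s`: the set `s` belongs to the additive Borel class `Σ⁰_ξ(τ)` (`1 ≤ ξ`).
The class `Σ⁰_1` consists of the open sets, and for `1 < ξ` the class `Σ⁰_ξ` consists of the
countable unions of sets whose complements lie in `Σ⁰_{η n}` with `1 ≤ η n < ξ`. -/
inductive SigmaZero {X : Type*} (τ : TopologicalSpace X) : Ordinal.{0} → Set X → Prop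
  | isOpen (s : Set X) (hs : IsOpen[τ] s) : SigmaZero τ 1 s
  | iUnion (ξ : Ordinal.{0}) (hξ : 1 < ξ) (η : ℕ → Ordinal.{0}) (s : ℕ → Set X)
      (hη : ∀ n, 1 ≤ η n ∧ η n < ξ) (hs : ∀ n, SigmaZero τ (η n) (s n)ᶜ) :
      SigmaZero τ ξ (⋃ n, s n)

/-- The multiplicative Borel class `Π⁰_ξ(τ)`: complements of `Σ⁰_ξ(τ)` sets. -/
def PiZero {X : Type*} (τ : TopologicalSpace X) (ξ : Ordinal.{0}) (s : Set X) : Prop :=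
  SigmaZero τ ξ sᶜ

/-- `IsBaireClass τ ξ f`: the function `f` is of Baire class `ξ` with respect to `τ`.
Class `0` means continuous; for `0 < ξ`, class `ξ` means pointwise limit of a sequence of
functions of classes `η n < ξ`. -/
inductive IsBaireClass {X : Type*} (τ : TopologicalSpace X) : Ordinal.{0} → (X → ℝ) → Prop
  | continuous (f : X → ℝ) (hf : @Continuous X ℝ τ inferInstance f) : IsBaireClass τ 0 f
  | limit (ξ : Ordinal.{0}) (hξ : 0 < ξ) (η : ℕ → Ordinal.{0}) (g : ℕ → X → ℝ) (f : X → ℝ)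
      (hη : ∀ n, η n < ξ) (hg : ∀ n, IsBaireClass τ (η n) (g n))
      (hf : ∀ x, Tendsto (fun n => g n x) atTop (𝓝 (f x))) : IsBaireClass τ ξ f

/-- `θ ≲ θ'`: for every `1 ≤ η < ω₁`, `θ' ≤ ω ^ η` implies `θ ≤ ω ^ η`. -/
def EssLE (θ θ' : Ordinal.{0}) : Prop :=
  ∀ η : Ordinal.{0}, 1 ≤ η → η < Ordinal.omega 1 →
    θ' ≤ Ordinal.omega0 ^ η → θ ≤ Ordinal.omega0 ^ η

/-- `θ ≈ θ'`: `θ ≲ θ'` and `θ' ≲ θ`. -/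
def EssEq (θ θ' : Ordinal.{0}) : Prop :=
  EssLE θ θ' ∧ EssLE θ' θ

/-- The iterated derivatives `D^η(X)` of the whole space: `D^0(X) = X`,
`D^{η+1}(X) = D(D^η(X))`, and `D^η(X) = ⋂_{θ<η} D^θ(X)` for limit `η`. -/
noncomputable def iterDeriv {X : Type*} (D : Set X → Set X) (η : Ordinal.{0}) : Set X :=
  Ordinal.limitRecOn (motive := fun _ => Set X) η univ (fun _ F => D F)
    (fun η _ ih => ⋂ θ : Iio η, ih θ.1 θ.2)

/-- The rank of a derivative: the least `η` with `D^η(X) = ∅`, and `ω₁` if there is none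
(below `ω₁`). -/
noncomputable def derivRank {X : Type*} (D : Set X → Set X) : Ordinal.{0} :=
  sInf (insert (Ordinal.omega 1) {η | iterDeriv D η = ∅})

/-- The derivative `D_{A,B}(F) = cl (F ∩ A) ∩ cl (F ∩ B)`. -/
def sepDeriv {X : Type*} (τ : TopologicalSpace X) (A B F : Set X) : Set X :=
  @closure X τ (F ∩ A) ∩ @closure X τ (F ∩ B)

/-- The separation rank `α_τ(f) = sup_{p < q rational} rk D_{{f ≤ p},{f ≥ q}}`. -/
noncomputable def separationRank {X : Type*} (τ : TopologicalSpace X) (f : X → ℝ) :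
    Ordinal.{0} :=
  ⨆ pq : {pq : ℚ × ℚ // pq.1 < pq.2},
    derivRank (sepDeriv τ {x | f x ≤ (pq.1.1 : ℝ)} {x | (pq.1.2 : ℝ) ≤ f x})

/-- The oscillation `ω(f, x, F)`, with values in `[0, ∞]`. -/
noncomputable def osc {X : Type*} (τ : TopologicalSpace X) (f : X → ℝ) (x : X) (F : Set X) :
    ENNReal :=
  ⨅ (U : Set X) (_ : IsOpen[τ] U) (_ : x ∈ U),
    ⨆ (x₁ ∈ U ∩ F) (x₂ ∈ U ∩ F), ENNReal.ofReal |f x₁ - f x₂|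

/-- The derivative `D_{f,ε}(F) = {x ∈ F : ω(f, x, F) ≥ ε}`. -/
def oscDeriv {X : Type*} (τ : TopologicalSpace X) (f : X → ℝ) (ε : ℝ) (F : Set X) : Set X :=
  {x ∈ F | ENNReal.ofReal ε ≤ osc τ f x F}

/-- The oscillation rank `β_τ(f) = sup_{ε > 0} rk D_{f,ε}`. -/
noncomputable def oscillationRank {X : Type*} (τ : TopologicalSpace X) (f : X → ℝ) :
    Ordinal.{0} :=
  ⨆ ε : {ε : ℝ // 0 < ε}, derivRank (oscDeriv τ f ε.1)

/-- The oscillation `ω((g_n), x, F)` of a sequence of functions, with values in `[0, ∞]`. -/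
noncomputable def seqOsc {X : Type*} (τ : TopologicalSpace X) (g : ℕ → X → ℝ) (x : X)
    (F : Set X) : ENNReal :=
  ⨅ (U : Set X) (_ : IsOpen[τ] U) (_ : x ∈ U) (N : ℕ),
    ⨆ (m : ℕ) (_ : N ≤ m) (n : ℕ) (_ : N ≤ n) (y ∈ U ∩ F), ENNReal.ofReal |g m y - g n y|

/-- The derivative `D_{(g_n),ε}(F) = {x ∈ F : ω((g_n), x, F) ≥ ε}`. -/
def seqOscDeriv {X : Type*} (τ : TopologicalSpace X) (g : ℕ → X → ℝ) (ε : ℝ) (F : Set X) :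
    Set X :=
  {x ∈ F | ENNReal.ofReal ε ≤ seqOsc τ g x F}

/-- The convergence rank `γ_τ(f)`: the minimum of `sup_{ε > 0} rk D_{(g_n),ε}` over all
sequences `(g_n)` of `τ`-continuous functions converging pointwise to `f`. -/
noncomputable def convergenceRank {X : Type*} (τ : TopologicalSpace X) (f : X → ℝ) :
    Ordinal.{0} :=
  sInf {θ | ∃ g : ℕ → X → ℝ, (∀ n, @Continuous X ℝ τ inferInstance (g n)) ∧
    (∀ x, Tendsto (fun n => g n x) atTop (𝓝 (f x))) ∧
    θ = ⨆ ε : {ε : ℝ // 0 < ε}, derivRank (seqOscDeriv τ g ε.1)}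

/-- `T_{f,ξ}`: the Polish topologies `τ'` refining `τ`, consisting of `Σ⁰_ξ(τ)` sets, for which
`f` is of Baire class `1`. -/
def refinements {X : Type*} (τ : TopologicalSpace X) (ξ : Ordinal.{0}) (f : X → ℝ) :
    Set (TopologicalSpace X) :=
  {τ' | (∀ s, IsOpen[τ] s → IsOpen[τ'] s) ∧ @PolishSpace X τ' ∧
    (∀ s, IsOpen[τ'] s → SigmaZero τ ξ s) ∧ IsBaireClass τ' 1 f}

/-- `ρ*_ξ(f) = min_{τ' ∈ T_{f,ξ}} ρ_{τ'}(f)`. -/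
noncomputable def starRank {X : Type*} (ρ : TopologicalSpace X → (X → ℝ) → Ordinal.{0})
    (τ : TopologicalSpace X) (ξ : Ordinal.{0}) (f : X → ℝ) : Ordinal.{0} :=
  sInf ((fun τ' => ρ τ' f) '' refinements τ ξ f)

/-- `H` is the transfinite difference of a decreasing continuous sequence `(F_η)_{η < l}` of
`Π⁰_ξ(τ)` sets with `F_0 = X`. The sequence is extended by `F_η = ∅` for `l ≤ η`, so that
continuity at `l` says `⋂_{η < l} F_η = ∅` if `l` is a limit. An ordinal is even if it is of the
form `2 * δ`. -/
def IsTransfiniteDiff {X : Type*} (τ : TopologicalSpace X) (ξ l : Ordinal.{0}) (H : Set X) :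
    Prop :=
  ∃ F : Ordinal.{0} → Set X, F 0 = univ ∧ Antitone F ∧ (∀ η < l, PiZero τ ξ (F η)) ∧
    (∀ η, l ≤ η → F η = ∅) ∧ (∀ η, Order.IsSuccLimit η → F η = ⋂ θ : Iio η, F θ.1) ∧
    H = ⋃ (η : Ordinal.{0}) (_ : η < l) (_ : ∃ δ, η = 2 * δ), F η \ F (η + 1)

/-- `α_ξ(A,B)`: the least length of a decreasing continuous sequence of `Π⁰_ξ` sets whose
transfinite difference separates `A` from `B` (`ω₁` if there is none of countable length). -/
noncomputable def sepLength {X : Type*} (τ : TopologicalSpace X) (ξ : Ordinal.{0})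
    (A B : Set X) : Ordinal.{0} :=
  sInf (insert (Ordinal.omega 1) {l | ∃ H, IsTransfiniteDiff τ ξ l H ∧ A ⊆ H ∧ H ⊆ Bᶜ})

/-- The separation rank `α_ξ(f) = sup_{p < q rational} α_ξ({f ≤ p}, {f ≥ q})` on the functions
of Baire class `ξ`. -/
noncomputable def classSeparationRank {X : Type*} (τ : TopologicalSpace X) (ξ : Ordinal.{0})
    (f : X → ℝ) : Ordinal.{0} :=
  ⨆ pq : {pq : ℚ × ℚ // pq.1 < pq.2},
    sepLength τ ξ {x | f x ≤ (pq.1.1 : ℝ)} {x | (pq.1.2 : ℝ) ≤ f x}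

end BaireRank

/-! In every single topology `α ≤ β ≤ γ`. A point of `D_{A,B}(F)` sees values `≤ p` and `≥ q`
arbitrarily close by, so `f` oscillates there by at least `q - p`; and where continuous functions
converge almost uniformly, their limit oscillates little. Minima over `T_{f,ξ}` inherit both
inequalities, so it remains to close the cycle by passing bounds `ω ^ η` from `α*` to `α_ξ` and from
`α_ξ` to `γ*`.

From `α*` to `α_ξ`: interleave the iterates `P_δ` of the separation derivative with the sets `cl
(P_δ ∩ B)`. This gives a transfinite difference of twice the length, and `2 * ω ^ η = ω ^ η` for `η
≥ 1` (`isTransfiniteDiff_of_iterDeriv`, `two_mul_opow`).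

From `α_ξ` to `γ*`: a separating difference for each rational pair involves only countably many
`Π⁰_ξ` sets in all, so one Polish refinement within `Σ⁰_ξ` makes them all closed
(`exists_polish_isOpen`). There each separating set has continuous approximants that, near any point
and along the level set of its rank, are eventually constant (`IsTransfiniteDiff.exists_seq`).
Iterated trisection of an interval containing the range of `f` assembles these into continuous
functions converging to `f`. To a given precision only finitely many pairs matter; the natural sum
of their ranks stays below `ω ^ η` and dominates the convergence derivative (`convergenceRank_le`).

Countability comes from the Baire category theorem, which bounds `γ` in every admissible refinement.
-/

namespace BaireRank

/-! ### Ordinals -/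

/-- The natural (Hessenberg) sum of two ordinals. -/
noncomputable def natSum (a b : Ordinal.{0}) : Ordinal.{0} :=
  max (⨆ x : Iio a, Order.succ (natSum x.1 b)) (⨆ x : Iio b, Order.succ (natSum a x.1))
termination_by (a, b)
decreasing_by
  · exact Prod.Lex.left _ _ x.2
  · exact Prod.Lex.right _ x.2

theorem natSum_le_iff {a b c : Ordinal.{0}} :
    natSum a b ≤ c ↔ (∀ x < a, natSum x b < c) ∧ ∀ x < b, natSum a x < c := by
  rw [natSum, max_le_iff, Ordinal.iSup_le_iff, Ordinal.iSup_le_iff]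
  simp

theorem natSum_lt_left {a a' : Ordinal.{0}} (h : a < a') (b : Ordinal.{0}) :
    natSum a b < natSum a' b :=
  (natSum_le_iff.1 le_rfl).1 a h

theorem natSum_lt_right (a : Ordinal.{0}) {b b' : Ordinal.{0}} (h : b < b') :
    natSum a b < natSum a b' :=
  (natSum_le_iff.1 le_rfl).2 b h

theorem natSum_le_natSum {a a' b b' : Ordinal.{0}} (h : a ≤ a') (h' : b ≤ b') :
    natSum a b ≤ natSum a' b' := by
  have h₁ : natSum a b ≤ natSum a' b := by
    rcases h.eq_or_lt with rfl | h
    exacts [le_rfl, (natSum_lt_left h b).le]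
  have h₂ : natSum a' b ≤ natSum a' b' := by
    rcases h'.eq_or_lt with rfl | h
    exacts [le_rfl, (natSum_lt_right a' h).le]
  exact h₁.trans h₂

/-- Strict monotonicity in each argument is the reason for using the natural sum: if neither rank
increases and their sum does not drop, then neither rank has dropped. Ordinary ordinal addition
lacks this. -/
theorem eq_and_eq_of_natSum_le {a a' b b' : Ordinal.{0}} (h : a ≤ a') (h' : b ≤ b')
    (hs : natSum a' b' ≤ natSum a b) : a = a' ∧ b = b' := by
  constructor
  · by_contra hne
    exact (((natSum_lt_left (lt_of_le_of_ne h hne) b).trans_le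
      (natSum_le_natSum le_rfl h')).trans_le hs).false
  · by_contra hne
    exact (((natSum_le_natSum h le_rfl).trans_lt
      (natSum_lt_right a' (lt_of_le_of_ne h' hne))).trans_le hs).false

/-- Below `c * ω` the quotients by `c` are natural numbers, so they add commutatively, and the
remainders stay below `c` by `hQ`. This is the successor step for powers of `ω`. -/
theorem natSum_le_mul_add {c : Ordinal.{0}} (hc : 0 < c)
    (hQ : ∀ a < c, ∀ b < c, natSum a b < c) (a b : Ordinal.{0})
    (ha : a < c * Ordinal.omega0) (hb : b < c * Ordinal.omega0) :
    natSum a b ≤ c * (a / c + b / c) + natSum (a % c) (b % c) := by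
  have hlt : ∀ x, x < c * Ordinal.omega0 → ∃ n : ℕ, x / c = n := fun x hx =>
    Ordinal.lt_omega0.1 ((Ordinal.lt_mul_iff_div_lt hc.ne').1 hx)
  have hmod : ∀ x y, natSum (x % c) (y % c) < c := fun x y =>
    hQ _ (Ordinal.mod_lt _ hc.ne') _ (Ordinal.mod_lt _ hc.ne')
  -- Either the quotient grows, which leaves room for a whole extra `c` to absorb any remainder, or
  -- only the remainder grows.
  have key : ∀ x y z, x < y → y < c * Ordinal.omega0 → z < c * Ordinal.omega0 →
      (x / c < y / c ∧ c * (x / c + z / c) + c ≤ c * (y / c + z / c) ∧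
        c * (z / c + x / c) + c ≤ c * (z / c + y / c)) ∨ (x / c = y / c ∧ x % c < y % c) := by
    intro x y z hxy hy hz
    rcases (Ordinal.div_le_left hxy.le c).lt_or_eq with h | h
    · left
      obtain ⟨n, hn⟩ := hlt x (hxy.trans hy)
      obtain ⟨m, hm⟩ := hlt y hy
      obtain ⟨k, hk⟩ := hlt z hz
      refine ⟨h, ?_, ?_⟩
      all_goals
        rw [hn, hm] at h
        rw [hn, hm, hk, ← mul_add_one]
        have : n < m := by exact_mod_cast h
        exact mul_le_mul' le_rfl (by norm_cast; omega)
    · right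
      refine ⟨h, ?_⟩
      rw [← Ordinal.div_add_mod x c, ← Ordinal.div_add_mod y c, h] at hxy
      exact (add_lt_add_iff_left _).1 hxy
  rw [natSum_le_iff]
  constructor
  · intro x hx
    have ih := natSum_le_mul_add hc hQ x b (hx.trans ha) hb
    refine ih.trans_lt ?_
    rcases key x a b hx ha hb with ⟨-, h, -⟩ | ⟨h, h'⟩
    · calc _ < c * (x / c + b / c) + c := by gcongr; exact hmod _ _
        _ ≤ _ := h.trans le_self_add
    · rw [h]
      gcongr
      exact natSum_lt_left h' _
  · intro x hx
    have ih := natSum_le_mul_add hc hQ a x ha (hx.trans hb)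
    refine ih.trans_lt ?_
    rcases key x b a hx hb ha with ⟨-, -, h⟩ | ⟨h, h'⟩
    · calc _ < c * (a / c + x / c) + c := by gcongr; exact hmod _ _
        _ ≤ _ := h.trans le_self_add
    · rw [h]
      gcongr
      exact natSum_lt_right _ h'
termination_by (a, b)
decreasing_by
  · exact Prod.Lex.left _ _ hx
  · exact Prod.Lex.right _ hx

theorem natSum_lt_opow (η : Ordinal.{0}) :
    ∀ a < Ordinal.omega0 ^ η, ∀ b < Ordinal.omega0 ^ η, natSum a b < Ordinal.omega0 ^ η := by
  induction η using Ordinal.limitRecOn with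
  | zero =>
    intro a ha b hb
    rw [Ordinal.opow_zero, Order.lt_one_iff] at *
    subst ha hb
    exact nonpos_iff_eq_zero.1 (natSum_le_iff.2 ⟨by simp, by simp⟩)
  | add_one η ih =>
    intro a ha b hb
    have hc : (0 : Ordinal.{0}) < Ordinal.omega0 ^ η := Ordinal.opow_pos _ Ordinal.omega0_pos
    rw [Ordinal.opow_add, Ordinal.opow_one] at *
    obtain ⟨n, hn⟩ := Ordinal.lt_omega0.1 ((Ordinal.lt_mul_iff_div_lt hc.ne').1 ha)
    obtain ⟨m, hm⟩ := Ordinal.lt_omega0.1 ((Ordinal.lt_mul_iff_div_lt hc.ne').1 hb)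
    refine (natSum_le_mul_add hc ih a b ha hb).trans_lt ?_
    calc _ < Ordinal.omega0 ^ η * (a / Ordinal.omega0 ^ η + b / Ordinal.omega0 ^ η)
            + Ordinal.omega0 ^ η := by
          gcongr
          exact ih _ (Ordinal.mod_lt _ hc.ne') _ (Ordinal.mod_lt _ hc.ne')
      _ = Ordinal.omega0 ^ η * ((n + m + 1 : ℕ) : Ordinal.{0}) := by
          rw [hn, hm, ← mul_add_one]; push_cast; rfl
      _ < _ := by
          gcongr
          exact Ordinal.natCast_lt_omega0 _
  | limit η hη ih =>
    intro a ha b hb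
    rw [Ordinal.lt_opow_of_isSuccLimit Ordinal.omega0_ne_zero hη] at *
    obtain ⟨c, hc, hac⟩ := ha
    obtain ⟨d, hd, hbd⟩ := hb
    refine ⟨max c d, max_lt hc hd, ih _ (max_lt hc hd) a (hac.trans_le ?_) b (hbd.trans_le ?_)⟩
    exacts [Ordinal.opow_le_opow_right Ordinal.omega0_pos (le_max_left _ _),
      Ordinal.opow_le_opow_right Ordinal.omega0_pos (le_max_right _ _)]

theorem countable_Iio_iff {o : Ordinal.{0}} : Countable (Iio o) ↔ o < Ordinal.omega 1 := by
  rw [← Cardinal.mk_le_aleph0_iff, Cardinal.mk_Iio_ordinal, Cardinal.lift_le_aleph0,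
    ← Cardinal.ord_aleph, Cardinal.lt_ord, ← Cardinal.succ_aleph0, Order.lt_succ_iff]

theorem opow_lt_omega_one {η : Ordinal.{0}} (hη : η < Ordinal.omega 1) :
    Ordinal.omega0 ^ η < Ordinal.omega 1 :=
  Ordinal.isPrincipal_opow_omega 1 Ordinal.omega0_lt_omega_one hη

theorem two_mul_opow {η : Ordinal.{0}} (hη : 1 ≤ η) :
    2 * Ordinal.omega0 ^ η = Ordinal.omega0 ^ η := by
  obtain ⟨δ, rfl⟩ : ∃ δ, η = 1 + δ := ⟨η - 1, (Ordinal.add_sub_cancel_of_le hη).symm⟩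
  rw [Ordinal.opow_add, Ordinal.opow_one, ← mul_assoc]
  congr 1
  exact_mod_cast Ordinal.natCast_mul_omega0 (n := 2) two_pos

/-! ### Iterated derivatives -/

section iterate

variable {X : Type*} {D D' : Set X → Set X}

@[simp]
theorem iterDeriv_zero : iterDeriv D 0 = univ := by
  simp [iterDeriv]

@[simp]
theorem iterDeriv_add_one (η : Ordinal.{0}) : iterDeriv D (η + 1) = D (iterDeriv D η) := by
  simp [iterDeriv]

theorem iterDeriv_limit {η : Ordinal.{0}} (hη : Order.IsSuccLimit η) :
    iterDeriv D η = ⋂ θ : Iio η, iterDeriv D θ.1 := by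
  rw [iterDeriv, Ordinal.limitRecOn_limit _ _ _ _ hη]
  rfl

theorem antitone_of_continuous {F : Ordinal.{0} → Set X} (hs : ∀ η, F (η + 1) ⊆ F η)
    (hl : ∀ η, Order.IsSuccLimit η → F η = ⋂ θ : Iio η, F θ.1) : Antitone F := by
  intro θ η
  induction η using Ordinal.limitRecOn with
  | zero => intro h; rw [nonpos_iff_eq_zero.1 h]
  | add_one η ih =>
    intro h
    rcases h.eq_or_lt with rfl | h
    · exact le_rfl
    · exact (hs η).trans (ih (Order.lt_add_one_iff.1 h))
  | limit η hη ih =>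
    intro h
    rcases h.eq_or_lt with rfl | h
    · exact le_rfl
    · rw [hl η hη]
      exact iInter_subset (fun θ : Iio η => F θ.1) ⟨θ, h⟩

theorem antitone_iterDeriv (h : ∀ η, D (iterDeriv D η) ⊆ iterDeriv D η) :
    Antitone (iterDeriv D) :=
  antitone_of_continuous (fun η => by rw [iterDeriv_add_one]; exact h η)
    fun _ => iterDeriv_limit

theorem isClosed_iterDeriv [TopologicalSpace X]
    (h : ∀ F, IsClosed F → IsClosed (D F)) (η : Ordinal.{0}) : IsClosed (iterDeriv D η) := by
  induction η using Ordinal.limitRecOn with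
  | zero => simp
  | add_one η ih => rw [iterDeriv_add_one]; exact h _ ih
  | limit η hη ih => rw [iterDeriv_limit hη]; exact isClosed_iInter fun θ => ih θ.1 θ.2

/-- The bound `Q` need not consist of iterates: it is applied both to another derivative and to
superlevel sets of a rank function. -/
theorem iterDeriv_subset {Q : Ordinal.{0} → Set X} (h0 : Q 0 = univ)
    (hs : ∀ η, iterDeriv D η ⊆ Q η → D (iterDeriv D η) ⊆ Q (η + 1))
    (hl : ∀ η, Order.IsSuccLimit η → Q η = ⋂ θ : Iio η, Q θ.1) (η : Ordinal.{0}) :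
    iterDeriv D η ⊆ Q η := by
  induction η using Ordinal.limitRecOn with
  | zero => simp [h0]
  | add_one η ih => rw [iterDeriv_add_one]; exact hs η ih
  | limit η hη ih =>
    rw [iterDeriv_limit hη, hl η hη]
    exact iInter_mono fun θ => ih θ.1 θ.2

theorem derivRank_le_omega_one : derivRank D ≤ Ordinal.omega 1 :=
  csInf_le' (mem_insert _ _)

theorem derivRank_le {η : Ordinal.{0}} (h : iterDeriv D η = ∅) : derivRank D ≤ η :=
  csInf_le' (mem_insert_of_mem _ h)

theorem iterDeriv_derivRank (h : derivRank D < Ordinal.omega 1) :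
    iterDeriv D (derivRank D) = ∅ := by
  rcases csInf_mem (insert_nonempty (Ordinal.omega 1) {η | iterDeriv D η = ∅}) with h' | h'
  · exact absurd h' h.ne
  · exact h'

theorem derivRank_le_derivRank (h : ∀ η, iterDeriv D η ⊆ iterDeriv D' η) :
    derivRank D ≤ derivRank D' := by
  rcases derivRank_le_omega_one (D := D') |>.lt_or_eq with h' | h'
  · exact derivRank_le (subset_empty_iff.1 ((h _).trans (iterDeriv_derivRank h').subset))
  · rw [h']; exact derivRank_le_omega_one

/-- The hypothesis concerns only iterates of `D`, because `sepDeriv` shrinks closed sets but not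
arbitrary ones. -/
theorem derivRank_mono (h : ∀ η F', iterDeriv D η ⊆ F' → D (iterDeriv D η) ⊆ D' F') :
    derivRank D ≤ derivRank D' :=
  derivRank_le_derivRank <| iterDeriv_subset iterDeriv_zero
    (fun η hη => by rw [iterDeriv_add_one]; exact h η _ hη) fun _ => iterDeriv_limit

/-- In a second countable space a decreasing family of closed sets is strictly decreasing only
countably many times. -/
theorem exists_succ_eq [TopologicalSpace X] [SecondCountableTopology X]
    {F : Ordinal.{0} → Set X} (hF : Antitone F) (hc : ∀ η, IsClosed (F η)) :
    ∃ η < Ordinal.omega 1, F (η + 1) = F η := by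
  by_contra! hne
  have hB := TopologicalSpace.isBasis_countableBasis X
  -- Each strict drop is witnessed by a basic open set meeting `F η` but not `F (η + 1)`; different
  -- drops need different sets, so `ω₁` would inject into a countable basis.
  have hU : ∀ η : Iio (Ordinal.omega.{0} 1), ∃ U : TopologicalSpace.countableBasis X,
      (U.1 ∩ F η.1).Nonempty ∧ U.1 ∩ F (η.1 + 1) = ∅ := by
    intro η
    obtain ⟨x, hx, hx'⟩ : ∃ x ∈ F η.1, x ∉ F (η.1 + 1) := by
      by_contra! hcon
      exact hne η.1 η.2 ((hF (le_self_add)).antisymm hcon)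
    obtain ⟨U, hU, hxU, hUF⟩ := hB.exists_subset_of_mem_open (show x ∈ (F (η.1 + 1))ᶜ from hx')
      (hc _).isOpen_compl
    exact ⟨⟨U, hU⟩, ⟨x, hxU, hx⟩, disjoint_iff_inter_eq_empty.1 (subset_compl_iff_disjoint_right.1 hUF)⟩
  choose U hU hU' using hU
  have hlt : ∀ η θ : Iio (Ordinal.omega.{0} 1), η < θ → U η ≠ U θ := by
    intro η θ h heq
    have h1 := hU θ
    rw [← heq] at h1
    have : F θ.1 ⊆ F (η.1 + 1) := hF (Order.add_one_le_of_lt h)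
    exact (h1.mono (inter_subset_inter_right _ this)).ne_empty (hU' η)
  have hinj : Function.Injective U := by
    intro η θ h
    rcases lt_trichotomy η θ with h' | h' | h'
    exacts [absurd h (hlt _ _ h'), h', absurd h.symm (hlt _ _ h')]
  have : Countable (TopologicalSpace.countableBasis X) :=
    (TopologicalSpace.countable_countableBasis X).to_subtype
  exact lt_irrefl _ (countable_Iio_iff.1 hinj.countable)

end iterate

/-- A supremum of ordinals over the positive reals, antitone in the real, is a countable one. -/
theorem iSup_pos_lt_omega_one {r : ℝ → Ordinal.{0}}
    (hr : ∀ ε δ, 0 < ε → ε ≤ δ → r δ ≤ r ε) (h : ∀ ε, 0 < ε → r ε < Ordinal.omega 1) :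
    (⨆ ε : {ε : ℝ // 0 < ε}, r ε.1) < Ordinal.omega 1 := by
  refine lt_of_le_of_lt ?_ (Ordinal.iSup_lt_omega_one
    (fun n : ℕ => h (1 / ((n : ℝ) + 1)) (by positivity)))
  refine Ordinal.iSup_le fun ε => ?_
  obtain ⟨n, hn⟩ := exists_nat_one_div_lt ε.2
  exact (hr _ _ (by positivity) hn.le).trans
    (Ordinal.le_iSup (fun n : ℕ => r (1 / ((n : ℝ) + 1))) n)

/-! ### Borel classes -/

section borel

variable {X : Type*} {τ : TopologicalSpace X} {ξ η : Ordinal.{0}} {s t : Set X}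

theorem sigmaZero_iff : SigmaZero τ ξ s ↔ (ξ = 1 ∧ IsOpen[τ] s) ∨
    (1 < ξ ∧ ∃ (η : ℕ → Ordinal.{0}) (t : ℕ → Set X), (∀ n, 1 ≤ η n ∧ η n < ξ) ∧
      (∀ n, SigmaZero τ (η n) (t n)ᶜ) ∧ s = ⋃ n, t n) := by
  constructor
  · intro h
    cases h with
    | isOpen _ hs => exact Or.inl ⟨rfl, hs⟩
    | iUnion _ hξ η t hη ht => exact Or.inr ⟨hξ, η, t, hη, ht, rfl⟩
  · rintro (⟨rfl, h⟩ | ⟨hξ, η, t, hη, ht, rfl⟩)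
    exacts [.isOpen _ h, .iUnion _ hξ η t hη ht]

theorem SigmaZero.one_le (h : SigmaZero τ ξ s) : 1 ≤ ξ := by
  rcases sigmaZero_iff.1 h with h | h
  exacts [h.1.ge, h.1.le]

theorem sigmaZero_one : SigmaZero τ 1 s ↔ IsOpen[τ] s := by
  rw [sigmaZero_iff]; simp

theorem SigmaZero.exists_iUnion (h : SigmaZero τ ξ s) (hξ : 1 < ξ) :
    ∃ (η : ℕ → Ordinal.{0}) (t : ℕ → Set X), (∀ n, 1 ≤ η n ∧ η n < ξ) ∧
      (∀ n, SigmaZero τ (η n) (t n)ᶜ) ∧ s = ⋃ n, t n := by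
  rcases sigmaZero_iff.1 h with h | h
  exacts [absurd h.1 hξ.ne', h.2]

theorem SigmaZero.of_compl (h : SigmaZero τ η sᶜ) (hξ : η < ξ) : SigmaZero τ ξ s := by
  rw [← iUnion_const (ι := ℕ) s]
  exact .iUnion _ (h.one_le.trans_lt hξ) (fun _ => η) _ (fun _ => ⟨h.one_le, hξ⟩) fun _ => h

/-- Only level one needs topology: open sets of a metrizable space are countable unions of closed
sets. -/
theorem SigmaZero.mono [@PolishSpace X τ] (h : SigmaZero τ η s) (hξ : η ≤ ξ) :
    SigmaZero τ ξ s := by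
  rcases hξ.eq_or_lt with rfl | hlt
  · exact h
  rcases sigmaZero_iff.1 h with ⟨rfl, ho⟩ | ⟨h1, θ, t, hθ, ht, rfl⟩
  · let := TopologicalSpace.upgradeIsCompletelyMetrizable X
    obtain ⟨F, hF, -, rfl, -⟩ := ho.exists_iUnion_isClosed
    exact .iUnion _ hlt (fun _ => 1) _ (fun _ => ⟨le_rfl, hlt⟩)
      fun n => sigmaZero_one.2 (hF n).isOpen_compl
  · exact .iUnion _ (h1.trans hlt) θ t (fun n => ⟨(hθ n).1, (hθ n).2.trans hlt⟩) ht

theorem SigmaZero.iUnion_nat {s : ℕ → Set X} (h : ∀ n, SigmaZero τ ξ (s n)) :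
    SigmaZero τ ξ (⋃ n, s n) := by
  rcases (h 0).one_le.eq_or_lt with rfl | hξ
  · exact sigmaZero_one.2 (isOpen_iUnion fun n => sigmaZero_one.1 (h n))
  · choose θ t hθ ht hs using fun n => (h n).exists_iUnion hξ
    have : ⋃ n, s n = ⋃ n : ℕ, t n.unpair.1 n.unpair.2 := by
      simp_rw [hs]
      exact (iUnion_unpair (fun i j => t i j)).symm
    rw [this]
    exact .iUnion _ hξ (fun n => θ n.unpair.1 n.unpair.2) _ (fun n => hθ _ _) fun n => ht _ _

theorem SigmaZero.iUnion_countable {ι : Sort*} [Countable ι] [Nonempty ι] {s : ι → Set X}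
    (h : ∀ i, SigmaZero τ ξ (s i)) : SigmaZero τ ξ (⋃ i, s i) := by
  obtain ⟨e, he⟩ := exists_surjective_nat ι
  rw [← he.iUnion_comp]
  exact .iUnion_nat fun n => h _

theorem SigmaZero.of_isOpen [@PolishSpace X τ] (hξ : 1 ≤ ξ) (h : IsOpen[τ] s) :
    SigmaZero τ ξ s :=
  (sigmaZero_one.2 h).mono hξ

theorem SigmaZero.union (hs : SigmaZero τ ξ s) (ht : SigmaZero τ ξ t) :
    SigmaZero τ ξ (s ∪ t) := by
  rw [union_eq_iUnion]
  exact .iUnion_countable fun b => by cases b <;> assumption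

theorem SigmaZero.inter [@PolishSpace X τ] (hs : SigmaZero τ ξ s) (ht : SigmaZero τ ξ t) :
    SigmaZero τ ξ (s ∩ t) := by
  rcases hs.one_le.eq_or_lt with rfl | hξ
  · exact sigmaZero_one.2 ((sigmaZero_one.1 hs).inter (sigmaZero_one.1 ht))
  · obtain ⟨θ, s, hθ, hs', rfl⟩ := hs.exists_iUnion hξ
    obtain ⟨θ', t, hθ', ht', rfl⟩ := ht.exists_iUnion hξ
    have heq : (⋃ n, s n) ∩ ⋃ n, t n = ⋃ p : ℕ × ℕ, s p.1 ∩ t p.2 := by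
      ext x
      simp
    rw [heq]
    refine .iUnion_countable fun p => ?_
    refine SigmaZero.of_compl (η := max (θ p.1) (θ' p.2)) ?_ (max_lt (hθ _).2 (hθ' _).2)
    rw [compl_inter]
    exact ((hs' _).mono (le_max_left _ _)).union ((ht' _).mono (le_max_right _ _))

/-! ### Refinements of Polish topologies -/

/-- The open sets of the join of countably many Polish topologies consisting of `Σ⁰_ξ` sets are
`Σ⁰_ξ`. -/
theorem SigmaZero.of_isOpen_iInf [@PolishSpace X τ] {ι : Type*} {t : ι → TopologicalSpace X}
    [@PolishSpace X (⨅ i, t i)] (hξ : 1 ≤ ξ)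
    (h : ∀ i s, IsOpen[t i] s → SigmaZero τ ξ s) (hs : IsOpen[⨅ i, t i] s) :
    SigmaZero τ ξ s := by
  have hB := @TopologicalSpace.isTopologicalBasis_of_subbasis X (⨅ i, t i) _
    (generateFrom_iUnion_isOpen t).symm
  obtain ⟨B, hBs, hBc, rfl⟩ :=
    @TopologicalSpace.IsTopologicalBasis.exists_countable_biUnion_of_isOpen X (⨅ i, t i)
      inferInstance _ hB _ hs
  rw [biUnion_eq_iUnion]
  have := hBc.to_subtype
  rcases isEmpty_or_nonempty B with hE | hE
  · rw [iUnion_of_empty]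
    exact .of_isOpen hξ (@isOpen_empty X τ)
  refine .iUnion_countable fun b => ?_
  obtain ⟨F, ⟨hF, hFs⟩, hb⟩ := hBs b.2
  rw [← hb]
  clear hb
  induction F, hF using Set.Finite.induction_on with
  | empty => simpa using SigmaZero.of_isOpen hξ (@isOpen_univ X τ)
  | insert _ _ ih =>
    rw [insert_subset_iff] at hFs
    obtain ⟨i, hi⟩ := mem_iUnion.1 hFs.1
    simpa only [sInter_insert] using (h i _ hi).inter (ih hFs.2)

/-- A closed set of a Polish space can be made open by adding only sets `V ∪ (W ∩ s)` with `V`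
and `W` open. -/
theorem exists_polish_isOpen_of_isClosed [@PolishSpace X τ] (hs : IsClosed[τ] s) :
    ∃ t' : TopologicalSpace X, (∀ U, IsOpen[τ] U → IsOpen[t'] U) ∧
      @PolishSpace X t' ∧ IsOpen[t'] s ∧
      ∀ U, IsOpen[t'] U → ∃ V W, IsOpen[τ] V ∧ IsOpen[τ] W ∧ U = V ∪ (W ∩ s) := by
  classical
  have : PolishSpace s := hs.polishSpace
  let t : Set X := sᶜ
  have : PolishSpace t := hs.isOpen_compl.polishSpace
  -- The new topology is that of the disjoint sum of `s` and its complement, both Polish.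
  let f : s ⊕ t ≃ X := Equiv.Set.sumCompl s
  refine ⟨.coinduced f instTopologicalSpaceSum, ?_, ?_, ?_, ?_⟩
  · intro U hU
    rw [isOpen_coinduced, isOpen_sum_iff]
    exact ⟨hU.preimage continuous_subtype_val, hU.preimage continuous_subtype_val⟩
  · rw [← f.induced_symm]
    exact f.symm.polishSpace_induced
  · rw [isOpen_coinduced, isOpen_sum_iff]
    simp [preimage_preimage, f, t]
  · intro U hU
    rw [isOpen_coinduced, isOpen_sum_iff] at hU
    obtain ⟨W, hW, hW'⟩ := isOpen_induced_iff.1 hU.1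
    obtain ⟨V, hV, hV'⟩ := isOpen_induced_iff.1 hU.2
    refine ⟨V ∩ sᶜ, W, hV.inter hs.isOpen_compl, hW, ?_⟩
    ext x
    by_cases hx : x ∈ s
    · have : x ∈ W ↔ x ∈ U := Set.ext_iff.1 hW' ⟨x, hx⟩
      simp [hx, this]
    · have : x ∈ V ↔ x ∈ U := Set.ext_iff.1 hV' ⟨x, hx⟩
      simp [hx, this]

/-- Countably many `Σ⁰_ξ` sets are open in some finer Polish topology consisting of `Σ⁰_ξ`
sets. -/
theorem exists_polish_isOpen [hτ : @PolishSpace X τ] (hξ : 1 ≤ ξ) (S : ℕ → Set X)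
    (hS : ∀ n, SigmaZero τ ξ (S n)) : ∃ τ' : TopologicalSpace X,
      (∀ s, IsOpen[τ] s → IsOpen[τ'] s) ∧ @PolishSpace X τ' ∧
      (∀ s, IsOpen[τ'] s → SigmaZero τ ξ s) ∧ ∀ n, IsOpen[τ'] (S n) := by
  induction ξ using WellFoundedLT.induction generalizing S with
  | ind ξ ih =>
  rcases hξ.eq_or_lt with rfl | hlt
  · exact ⟨τ, fun _ h => h, hτ, fun _ => sigmaZero_one.2, fun n => sigmaZero_one.1 (hS n)⟩
  choose η s hη hs hSs using fun n => (hS n).exists_iUnion hlt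
  have step : ∀ p : ℕ × ℕ, ∃ t : TopologicalSpace X,
      (∀ u, IsOpen[τ] u → IsOpen[t] u) ∧ @PolishSpace X t ∧
      (∀ u, IsOpen[t] u → SigmaZero τ ξ u) ∧ IsOpen[t] (s p.1 p.2) := by
    rintro ⟨i, j⟩
    -- By induction the complement of the piece becomes open, so the piece becomes closed and can
    -- then be made open as well.
    obtain ⟨t, ht, htP, htS, hto⟩ := ih (η i j) (hη i j).2 (hη i j).1 (fun _ => (s i j)ᶜ)
      fun _ => hs i j
    obtain ⟨t', ht', ht'P, hto', hU⟩ := exists_polish_isOpen_of_isClosed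
      (isOpen_compl_iff.1 (hto 0))
    refine ⟨t', fun u hu => ht' u (ht u hu), ht'P, fun u hu => ?_, hto'⟩
    obtain ⟨V, W, hV, hW, rfl⟩ := hU u hu
    have hle := (hη i j).2.le
    exact ((htS V hV).mono hle).union (((htS W hW).mono hle).inter
      (SigmaZero.of_compl (hs i j) (hη i j).2))
  choose t ht htP htS hto using step
  -- Including `τ` itself gives the family a coarsest member, as needed for the join to be Polish.
  let T : Option (ℕ × ℕ) → TopologicalSpace X := fun i => i.elim τ t
  have hP : @PolishSpace X (⨅ i, T i) :=
    .iInf ⟨none, Option.forall.2 ⟨le_rfl, fun p u hu => ht p u hu⟩⟩ <| Option.forall.2 ⟨hτ, htP⟩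
  refine ⟨⨅ i, T i, fun u hu => iInf_le T none u hu, hP, fun u hu => ?_, fun n => ?_⟩
  · refine SigmaZero.of_isOpen_iInf hξ ?_ hu
    rintro (_ | p) v hv
    exacts [.of_isOpen hξ hv, htS p v hv]
  · rw [hSs]
    exact @isOpen_iUnion X ℕ (⨅ i, T i) _ fun m => iInf_le T (some (n, m)) _ (hto (n, m))

theorem isBaireClass_iff {f : X → ℝ} : IsBaireClass τ ξ f ↔
    (ξ = 0 ∧ @Continuous X ℝ τ inferInstance f) ∨
    (0 < ξ ∧ ∃ (η : ℕ → Ordinal.{0}) (g : ℕ → X → ℝ), (∀ n, η n < ξ) ∧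
      (∀ n, IsBaireClass τ (η n) (g n)) ∧ ∀ x, Tendsto (fun n => g n x) atTop (𝓝 (f x))) := by
  constructor
  · intro h
    cases h with
    | continuous _ hf => exact Or.inl ⟨rfl, hf⟩
    | limit _ hξ η g _ hη hg hf => exact Or.inr ⟨hξ, η, g, hη, hg, hf⟩
  · rintro (⟨rfl, h⟩ | ⟨hξ, η, g, hη, hg, hf⟩)
    exacts [.continuous _ h, .limit _ hξ η g _ hη hg hf]

theorem isBaireClass_one {f : X → ℝ} : IsBaireClass τ 1 f ↔
    ∃ g : ℕ → X → ℝ, (∀ n, @Continuous X ℝ τ inferInstance (g n)) ∧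
      ∀ x, Tendsto (fun n => g n x) atTop (𝓝 (f x)) := by
  constructor
  · intro h
    rcases isBaireClass_iff.1 h with ⟨h, -⟩ | ⟨-, η, g, hη, hg, hf⟩
    · exact absurd h one_ne_zero
    refine ⟨g, fun n => ?_, hf⟩
    rcases isBaireClass_iff.1 (hg n) with ⟨-, h⟩ | ⟨h, -⟩
    exacts [h, absurd (hη n) (by simpa using h.ne')]
  · rintro ⟨g, hg, hf⟩
    exact .limit _ one_pos (fun _ => 0) g f (fun _ => one_pos) (fun n => .continuous _ (hg n)) hf

/-- A limit exceeds `p` exactly when, for some `k`, the approximants are eventually at least `p + 1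
/ (k + 1)`: a countable union of `Π⁰_ξ` conditions. -/
theorem IsBaireClass.sigmaZero [@PolishSpace X τ] {f : X → ℝ} (h : IsBaireClass τ ξ f) (p : ℝ) :
    SigmaZero τ (ξ + 1) (f ⁻¹' Ioi p) ∧ SigmaZero τ (ξ + 1) (f ⁻¹' Iio p) := by
  induction h generalizing p with
  | continuous f hf =>
    rw [zero_add, sigmaZero_one, sigmaZero_one]
    exact ⟨isOpen_Ioi.preimage hf, isOpen_Iio.preimage hf⟩
  | limit ξ hξ η g f hη hg hf ih =>
    have h1 : 1 ≤ ξ := Order.one_le_iff_pos.2 hξ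
    constructor
    · have : f ⁻¹' Ioi p = ⋃ q : ℕ × ℕ,
          (⋃ n : ℕ, g (q.2 + n) ⁻¹' Iio (p + 1 / ((q.1 : ℝ) + 1)))ᶜ := by
        ext x
        simp only [mem_preimage, mem_Ioi, compl_iUnion, mem_iUnion, mem_iInter, mem_compl_iff,
          mem_Iio, not_lt]
        constructor
        · intro hx
          obtain ⟨k, hk⟩ := exists_nat_one_div_lt (sub_pos.2 hx)
          obtain ⟨N, hN⟩ := eventually_atTop.1
            ((hf x).eventually_const_lt (show p + 1 / ((k : ℝ) + 1) < f x by linarith))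
          exact ⟨(k, N), fun n => (hN _ (Nat.le_add_right _ _)).le⟩
        · rintro ⟨⟨k, N⟩, h⟩
          have : p + 1 / ((k : ℝ) + 1) ≤ f x := ge_of_tendsto (hf x)
            (eventually_atTop.2 ⟨N, fun n hn => by
              obtain ⟨m, rfl⟩ := Nat.exists_eq_add_of_le hn; exact h m⟩)
          have : 0 < 1 / ((k : ℝ) + 1) := by positivity
          linarith
      rw [this]
      refine .iUnion_countable fun q => SigmaZero.of_compl (η := ξ) ?_ (Order.lt_add_one_iff.2 le_rfl)
      rw [compl_compl]
      exact .iUnion_nat fun n => (ih _ _).2.mono (Order.add_one_le_of_lt (hη _))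
    · have : f ⁻¹' Iio p = ⋃ q : ℕ × ℕ,
          (⋃ n : ℕ, g (q.2 + n) ⁻¹' Ioi (p - 1 / ((q.1 : ℝ) + 1)))ᶜ := by
        ext x
        simp only [mem_preimage, mem_Ioi, compl_iUnion, mem_iUnion, mem_iInter, mem_compl_iff,
          mem_Iio, not_lt]
        constructor
        · intro hx
          obtain ⟨k, hk⟩ := exists_nat_one_div_lt (sub_pos.2 hx)
          obtain ⟨N, hN⟩ := eventually_atTop.1
            ((hf x).eventually_lt_const (show f x < p - 1 / ((k : ℝ) + 1) by linarith))
          exact ⟨(k, N), fun n => (hN _ (Nat.le_add_right _ _)).le⟩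
        · rintro ⟨⟨k, N⟩, h⟩
          have : f x ≤ p - 1 / ((k : ℝ) + 1) := le_of_tendsto (hf x)
            (eventually_atTop.2 ⟨N, fun n hn => by
              obtain ⟨m, rfl⟩ := Nat.exists_eq_add_of_le hn; exact h m⟩)
          have : 0 < 1 / ((k : ℝ) + 1) := by positivity
          linarith
      rw [this]
      refine .iUnion_countable fun q => SigmaZero.of_compl (η := ξ) ?_ (Order.lt_add_one_iff.2 le_rfl)
      rw [compl_compl]
      exact .iUnion_nat fun n => (ih _ _).1.mono (Order.add_one_le_of_lt (hη _))

/-- It suffices to make the approximants `g n` continuous. Their class is `η n < ξ`, so preimages of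
rational rays are `Σ⁰` of level `η n + 1 ≤ ξ`, and there are countably many of them. -/
theorem refinements_nonempty [@PolishSpace X τ] (hξ : 1 ≤ ξ) {f : X → ℝ}
    (hf : IsBaireClass τ ξ f) : (refinements τ ξ f).Nonempty := by
  rcases isBaireClass_iff.1 hf with ⟨rfl, -⟩ | ⟨-, η, g, hη, hg, hlim⟩
  · exact absurd hξ (by simp)
  obtain ⟨e, he⟩ := exists_surjective_nat (ℕ × ℚ × Bool)
  let S : ℕ × ℚ × Bool → Set X := fun i =>
    g i.1 ⁻¹' (if i.2.2 then Ioi (i.2.1 : ℝ) else Iio (i.2.1 : ℝ))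
  have hS : ∀ i, SigmaZero τ ξ (S i) := by
    rintro ⟨n, q, b⟩
    have h := (hg n).sigmaZero q
    have hle := Order.add_one_le_of_lt (hη n)
    cases b
    exacts [h.2.mono hle, h.1.mono hle]
  obtain ⟨τ', h1, h2, h3, h4⟩ := exists_polish_isOpen hξ (fun n => S (e n)) fun n => hS _
  have h5 : ∀ i, IsOpen[τ'] (S i) := fun i => by
    obtain ⟨n, rfl⟩ := he i
    exact h4 n
  refine ⟨τ', h1, h2, h3, isBaireClass_one.2 ⟨g, fun n => ?_, hlim⟩⟩
  let := τ'
  rw [Real.isTopologicalBasis_Ioo_rat.continuous_iff]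
  simp only [mem_iUnion, mem_singleton_iff, exists_prop]
  rintro _ ⟨a, b, -, rfl⟩
  rw [← Ioi_inter_Iio, preimage_inter]
  exact (h5 (n, a, true)).inter (h5 (n, b, false))

end borel

/-! ### Comparison of the ranks of a fixed topology -/

section ranks

variable {X : Type*} [τ : TopologicalSpace X] {f : X → ℝ} {g : ℕ → X → ℝ} {x : X} {F F' U : Set X}
  {c ε δ : ℝ}

theorem osc_le (hU : IsOpen U) (hx : x ∈ U)
    (h : ∀ x₁ ∈ U ∩ F, ∀ x₂ ∈ U ∩ F, |f x₁ - f x₂| ≤ c) : osc τ f x F ≤ ENNReal.ofReal c :=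
  (iInf₂_le_of_le U hU (iInf_le _ hx)).trans
    (iSup₂_le fun x₁ h₁ => iSup₂_le fun x₂ h₂ => ENNReal.ofReal_le_ofReal (h x₁ h₁ x₂ h₂))

theorem le_osc (h : ∀ U, IsOpen U → x ∈ U → ∃ x₁ ∈ U ∩ F, ∃ x₂ ∈ U ∩ F, c ≤ |f x₁ - f x₂|) :
    ENNReal.ofReal c ≤ osc τ f x F := by
  refine le_iInf₂ fun U hU => le_iInf fun hx => ?_
  obtain ⟨x₁, h₁, x₂, h₂, hc⟩ := h U hU hx
  exact le_iSup₂_of_le x₁ h₁ (le_iSup₂_of_le x₂ h₂ (ENNReal.ofReal_le_ofReal hc))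

theorem seqOsc_le {N : ℕ} (hU : IsOpen U) (hx : x ∈ U)
    (h : ∀ m, N ≤ m → ∀ n, N ≤ n → ∀ y ∈ U ∩ F, |g m y - g n y| ≤ c) :
    seqOsc τ g x F ≤ ENNReal.ofReal c :=
  (iInf₂_le_of_le U hU (iInf_le_of_le hx (iInf_le _ N))).trans
    (iSup₂_le fun m hm => iSup₂_le fun n hn => iSup₂_le fun y hy =>
      ENNReal.ofReal_le_ofReal (h m hm n hn y hy))

theorem exists_of_seqOsc_lt (h : seqOsc τ g x F < ENNReal.ofReal c) :
    ∃ U, IsOpen U ∧ x ∈ U ∧ ∃ N, ∀ m, N ≤ m → ∀ n, N ≤ n → ∀ y ∈ U ∩ F, |g m y - g n y| < c := by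
  simp only [seqOsc, iInf_lt_iff] at h
  obtain ⟨U, hU, hx, N, h⟩ := h
  refine ⟨U, hU, hx, N, fun m hm n hn y hy => ?_⟩
  have hle : ENNReal.ofReal |g m y - g n y| < ENNReal.ofReal c := lt_of_le_of_lt
    (le_iSup₂_of_le m hm (le_iSup₂_of_le n hn
      (le_iSup₂ (f := fun y (_ : y ∈ U ∩ F) => ENNReal.ofReal |g m y - g n y|) y hy))) h
  exact lt_of_not_ge fun hc => hle.not_ge (ENNReal.ofReal_le_ofReal hc)

theorem seqOsc_mono (h : F ⊆ F') : seqOsc τ g x F ≤ seqOsc τ g x F' :=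
  iInf₂_mono fun _ _ => iInf₂_mono fun _ _ => iSup₂_mono fun _ _ => iSup₂_mono fun _ _ =>
    biSup_mono fun _ hy => ⟨hy.1, h hy.2⟩

theorem seqOscDeriv_subset_self : seqOscDeriv τ g ε F ⊆ F := sep_subset _ _

theorem seqOscDeriv_subset_seqOscDeriv (h : ε ≤ δ) (hF : F ⊆ F') :
    seqOscDeriv τ g δ F ⊆ seqOscDeriv τ g ε F' := fun _ hx =>
  ⟨hF hx.1, (ENNReal.ofReal_le_ofReal h).trans (hx.2.trans (seqOsc_mono hF))⟩

theorem isClosed_seqOscDeriv (hF : IsClosed F) : IsClosed (seqOscDeriv τ g ε F) := by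
  refine hF.inter (isOpen_compl_iff.1 (isOpen_iff_forall_mem_open.2 fun x hx => ?_))
  have hx : seqOsc τ g x F < ENNReal.ofReal ε := not_le.1 hx
  have hx' := hx
  simp only [seqOsc, iInf_lt_iff] at hx'
  obtain ⟨U, hU, hxU, N, h⟩ := hx'
  refine ⟨U, fun y hy => not_le.2 (lt_of_le_of_lt ?_ h), hU, hxU⟩
  exact iInf₂_le_of_le U hU (iInf_le_of_le hy (iInf_le _ N))

theorem isClosed_sepDeriv {A B : Set X} : IsClosed (sepDeriv τ A B F) :=
  isClosed_closure.inter isClosed_closure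

theorem sepDeriv_subset_self {A B : Set X} (hF : IsClosed F) : sepDeriv τ A B F ⊆ F := fun _ h =>
  closure_minimal inter_subset_left hF h.1

theorem isClosed_iterDeriv_sepDeriv {A B : Set X} (η : Ordinal.{0}) :
    IsClosed (iterDeriv (sepDeriv τ A B) η) :=
  isClosed_iterDeriv (fun _ _ => isClosed_sepDeriv) η

theorem separationRank_le_oscillationRank : separationRank τ f ≤ oscillationRank τ f := by
  refine Ordinal.iSup_le fun ⟨⟨p, q⟩, hpq⟩ => ?_
  have hpq' : (0 : ℝ) < q - p := sub_pos.2 (by exact_mod_cast hpq)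
  refine le_trans ?_ (Ordinal.le_iSup
    (fun ε : {ε : ℝ // 0 < ε} => derivRank (oscDeriv τ f ε.1)) ⟨(q : ℝ) - p, hpq'⟩)
  refine derivRank_mono fun η F' hF' x hx => ?_
  refine ⟨hF' (sepDeriv_subset_self (isClosed_iterDeriv_sepDeriv η) hx), le_osc fun U hU hxU => ?_⟩
  obtain ⟨x₁, hx₁, h₁, h₁'⟩ := mem_closure_iff.1 hx.1 U hU hxU
  obtain ⟨x₂, hx₂, h₂, h₂'⟩ := mem_closure_iff.1 hx.2 U hU hxU
  refine ⟨x₂, ⟨hx₂, hF' h₂⟩, x₁, ⟨hx₁, hF' h₁⟩, le_trans ?_ (le_abs_self _)⟩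
  have h₁'' : f x₁ ≤ p := h₁'
  have h₂'' : q ≤ f x₂ := h₂'
  linarith

theorem oscDeriv_subset_seqOscDeriv (hg : ∀ n, Continuous (g n))
    (hf : ∀ x, Tendsto (fun n => g n x) atTop (𝓝 (f x))) (hε : 0 < ε) (hF : F ⊆ F') :
    oscDeriv τ f ε F ⊆ seqOscDeriv τ g (ε / 4) F' := by
  intro x hx
  refine ⟨hF hx.1, ?_⟩
  by_contra! hlt
  obtain ⟨U, hU, hxU, N, h⟩ := exists_of_seqOsc_lt hlt
  have hlim : ∀ y ∈ U ∩ F', |g N y - f y| ≤ ε / 4 := fun y hy =>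
    le_of_tendsto ((tendsto_const_nhds.sub (hf y)).abs)
      (eventually_atTop.2 ⟨N, fun n hn => (h N le_rfl n hn y hy).le⟩)
  have hV : IsOpen (g N ⁻¹' Metric.ball (g N x) (ε / 8)) := Metric.isOpen_ball.preimage (hg N)
  -- Two passages from `f` to `g N` cost `ε / 4` each, and continuity of `g N` costs `ε / 8` twice:
  -- `3 * ε / 4 < ε` in total.
  have := osc_le (f := f) (F := F) (c := 3 * ε / 4) (hU.inter hV)
    ⟨hxU, Metric.mem_ball_self (by positivity)⟩ fun x₁ h₁ x₂ h₂ => by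
      have a₁ := abs_le.1 (hlim x₁ ⟨h₁.1.1, hF h₁.2⟩)
      have a₂ := abs_le.1 (hlim x₂ ⟨h₂.1.1, hF h₂.2⟩)
      have b₁ := abs_lt.1 (show |g N x₁ - g N x| < ε / 8 from h₁.1.2)
      have b₂ := abs_lt.1 (show |g N x₂ - g N x| < ε / 8 from h₂.1.2)
      exact abs_le.2 ⟨by linarith, by linarith⟩
  have h3 := hx.2.trans this
  rw [ENNReal.ofReal_le_ofReal_iff (by positivity)] at h3
  linarith

theorem oscillationRank_le_convergenceRank (hf : IsBaireClass τ 1 f) :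
    oscillationRank τ f ≤ convergenceRank τ f := by
  obtain ⟨g, hg, hlim⟩ := isBaireClass_one.1 hf
  refine le_csInf ⟨_, g, hg, hlim, rfl⟩ ?_
  rintro _ ⟨g, hg, hlim, rfl⟩
  refine Ordinal.iSup_le fun ε => ?_
  refine le_trans (derivRank_mono fun η F' hF' => ?_) (Ordinal.le_iSup
    (fun ε : {ε : ℝ // 0 < ε} => derivRank (seqOscDeriv τ g ε.1)) ⟨ε / 4, by have := ε.2; positivity⟩)
  exact oscDeriv_subset_seqOscDeriv hg hlim ε.2 hF'

/-- Baire category on `F`: the closed sets where the sequence is `ε / 2`-Cauchy from `N` on cover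
`F`, so one has interior, and its interior points drop out of the derivative. -/
theorem seqOscDeriv_ne_self [PolishSpace X] (hg : ∀ n, Continuous (g n))
    (hf : ∀ x, Tendsto (fun n => g n x) atTop (𝓝 (f x))) (hε : 0 < ε) (hF : IsClosed F)
    (hne : F.Nonempty) : seqOscDeriv τ g ε F ≠ F := by
  intro heq
  have : PolishSpace F := hF.polishSpace
  have : Nonempty F := hne.to_subtype
  let S : ℕ → Set F := fun N => {y | ∀ m, N ≤ m → ∀ n, N ≤ n → |g m y - g n y| ≤ ε / 2}
  have hS : ∀ N, IsClosed (S N) := by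
    intro N
    simp only [S, ofPred_forall]
    refine isClosed_iInter fun m => isClosed_iInter fun _ => isClosed_iInter fun n =>
      isClosed_iInter fun _ => isClosed_le ?_ continuous_const
    exact (((hg m).comp continuous_subtype_val).sub ((hg n).comp continuous_subtype_val)).abs
  have hU : ⋃ N, S N = univ := by
    refine eq_univ_of_forall fun y => mem_iUnion.2 ?_
    obtain ⟨N, hN⟩ := Metric.cauchySeq_iff.1 (hf y).cauchySeq (ε / 2) (by positivity)
    exact ⟨N, fun m hm n hn => (hN m hm n hn).le⟩
  obtain ⟨N, y, hy⟩ := nonempty_interior_of_iUnion_of_closed hS hU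
  obtain ⟨V, hV, hVo, hyV⟩ := mem_interior.1 hy
  obtain ⟨U, hU, rfl⟩ := isOpen_induced_iff.1 hVo
  have h1 : y.1 ∈ seqOscDeriv τ g ε F := heq.symm.subset y.2
  have h2 := h1.2.trans (seqOsc_le (N := N) (c := ε / 2) hU hyV fun m hm n hn z hz =>
    hV (show (⟨z, hz.2⟩ : F) ∈ Subtype.val ⁻¹' U from hz.1) m hm n hn)
  rw [ENNReal.ofReal_le_ofReal_iff (by positivity)] at h2
  linarith

theorem derivRank_seqOscDeriv_lt [PolishSpace X] (hg : ∀ n, Continuous (g n))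
    (hf : ∀ x, Tendsto (fun n => g n x) atTop (𝓝 (f x))) (hε : 0 < ε) :
    derivRank (seqOscDeriv τ g ε) < Ordinal.omega 1 := by
  have hc := isClosed_iterDeriv (D := seqOscDeriv τ g ε) fun _ => isClosed_seqOscDeriv
  obtain ⟨η, hη, h⟩ := exists_succ_eq (antitone_iterDeriv fun _ => seqOscDeriv_subset_self) hc
  rw [iterDeriv_add_one] at h
  refine (derivRank_le (not_nonempty_iff_eq_empty.1 fun hne => ?_)).trans_lt hη
  exact seqOscDeriv_ne_self hg hf hε (hc η) hne h

theorem convergenceRank_lt [PolishSpace X] (hf : IsBaireClass τ 1 f) :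
    convergenceRank τ f < Ordinal.omega 1 := by
  obtain ⟨g, hg, hlim⟩ := isBaireClass_one.1 hf
  refine lt_of_le_of_lt (csInf_le' ⟨g, hg, hlim, rfl⟩) ?_
  exact iSup_pos_lt_omega_one (r := fun ε => derivRank (seqOscDeriv τ g ε))
    (fun ε δ _ h => derivRank_mono fun η F' => seqOscDeriv_subset_seqOscDeriv h)
    fun ε => derivRank_seqOscDeriv_lt hg hlim

end ranks

/-! ### Transfinite differences -/

section differences

variable {X : Type*} {τ : TopologicalSpace X} {ξ l : Ordinal.{0}} {H : Set X}

/-- A decreasing continuous sequence of sets with empty end is given by a rank function. -/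
theorem exists_rank {F : Ordinal.{0} → Set X} (h0 : F 0 = univ) (hF : Antitone F)
    (hl : F l = ∅) (hlim : ∀ η, Order.IsSuccLimit η → F η = ⋂ θ : Iio η, F θ.1) :
    ∃ r : X → Ordinal.{0}, ∀ x θ, x ∈ F θ ↔ θ ≤ r x := by
  have : ∀ x, ∃ ρ, ∀ θ, x ∈ F θ ↔ θ ≤ ρ := by
    intro x
    -- The first stage omitting `x` is neither zero nor, by continuity, a limit; its predecessor is
    -- the rank of `x`.
    have hmem : sInf {θ | x ∉ F θ} ∈ {θ | x ∉ F θ} := csInf_mem ⟨l, by simp [hl]⟩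
    have hlt : ∀ θ < sInf {θ | x ∉ F θ}, x ∈ F θ := fun θ h => by
      by_contra hx
      exact notMem_of_lt_csInf' h hx
    generalize sInf {θ | x ∉ F θ} = σ at hmem hlt
    induction σ using Ordinal.limitRecOn with
    | zero => simp [h0] at hmem
    | add_one ρ _ =>
      refine ⟨ρ, fun θ => ⟨fun h => ?_, fun h => hlt θ (Order.lt_add_one_iff.2 h)⟩⟩
      by_contra! hρ
      exact hmem (hF (Order.add_one_le_of_lt hρ) h)
    | limit σ hσ _ =>
      refine absurd ?_ hmem
      rw [hlim σ hσ]
      exact mem_iInter.2 fun θ => hlt θ.1 θ.2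
  choose r hr using this
  exact ⟨r, hr⟩

theorem IsTransfiniteDiff.exists_rank (h : IsTransfiniteDiff τ 1 l H) :
    ∃ r : X → Ordinal.{0}, (∀ x, r x < l) ∧ (∀ θ, IsClosed[τ] {x | θ ≤ r x}) ∧
      ∀ x, x ∈ H ↔ ∃ δ, r x = 2 * δ := by
  obtain ⟨F, h0, hF, hP, hl, hlim, rfl⟩ := h
  obtain ⟨r, hr⟩ := BaireRank.exists_rank h0 hF (hl l le_rfl) hlim
  have hlt : ∀ x, r x < l := fun x => by
    by_contra! h
    have := (hr x l).2 h
    rw [hl l le_rfl] at this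
    exact this
  refine ⟨r, hlt, fun θ => ?_, fun x => ?_⟩
  · have : {x | θ ≤ r x} = F θ := by ext x; exact (hr x θ).symm
    rw [this]
    rcases lt_or_ge θ l with h | h
    · exact isOpen_compl_iff.1 (sigmaZero_one.1 (hP θ h))
    · rw [hl θ h]; exact @isClosed_empty X τ
  · simp only [mem_iUnion, Set.mem_sdiff, hr, exists_prop]
    constructor
    · rintro ⟨η, -, ⟨δ, hδ⟩, h1, h2⟩
      exact ⟨δ, by rw [← hδ]; exact le_antisymm (Order.lt_add_one_iff.1 (not_le.1 h2)) h1⟩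
    · rintro ⟨δ, hδ⟩
      exact ⟨r x, hlt x, ⟨δ, hδ⟩, le_rfl, not_le.2 (Order.lt_add_one_iff.2 le_rfl)⟩

/-- A transfinite difference of countably many `Π⁰_ξ` sets becomes one of closed sets once
countably many `Σ⁰_ξ` sets are open. -/
theorem IsTransfiniteDiff.exists_sigmaZero [Nonempty X] (hl : l < Ordinal.omega 1)
    (h : IsTransfiniteDiff τ ξ l H) : ∃ S : ℕ → Set X, (∀ n, SigmaZero τ ξ (S n)) ∧
      ∀ τ' : TopologicalSpace X, (∀ n, IsOpen[τ'] (S n)) → IsTransfiniteDiff τ' 1 l H := by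
  obtain ⟨F, h0, hF, hP, hl', hlim, rfl⟩ := h
  have hpos : 0 < l := by
    by_contra! h
    exact (univ_nonempty (α := X)).ne_empty (h0 ▸ hl' 0 h)
  have : Nonempty (Iio l) := ⟨⟨0, hpos⟩⟩
  have := countable_Iio_iff.2 hl
  obtain ⟨e, he⟩ := exists_surjective_nat (Iio l)
  refine ⟨fun n => (F (e n).1)ᶜ, fun n => hP _ (e n).2, fun τ' hτ' =>
    ⟨F, h0, hF, fun η hη => ?_, hl', hlim, rfl⟩⟩
  obtain ⟨n, hn⟩ := he ⟨η, hη⟩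
  have h : F η = F (e n).1 := by rw [hn]
  rw [h]
  exact sigmaZero_one.2 (hτ' n)

/-- The indicator of the complement of a transfinite difference of closed sets is the limit of
continuous functions which are locally eventually constant on the level sets of the rank. -/
theorem IsTransfiniteDiff.exists_seq [τ : TopologicalSpace X]
    [TopologicalSpace.MetrizableSpace X] [Nonempty X]
    (hl : l < Ordinal.omega 1) (h : IsTransfiniteDiff τ 1 l H) :
    ∃ (r : X → Ordinal.{0}) (g : ℕ → X → ℝ) (u : X → ℝ), (∀ x, r x < l) ∧
      (∀ θ, IsClosed {x | θ ≤ r x}) ∧ (∀ n, Continuous (g n)) ∧ (∀ n x, g n x ∈ Icc (0 : ℝ) 1) ∧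
      (∀ x ∈ H, u x = 0) ∧ (∀ x ∉ H, u x = 1) ∧
      ∀ x, ∀ᶠ N in atTop, ∀ᶠ y in 𝓝 x, r y = r x → ∀ n ≥ N, g n y = u x := by
  classical
  let := TopologicalSpace.metrizableSpaceMetric X
  obtain ⟨r, hrl, hr, hH⟩ := h.exists_rank
  have : Nonempty (Iio l) := ⟨⟨_, hrl (Classical.arbitrary X)⟩⟩
  have := countable_Iio_iff.2 hl
  obtain ⟨e, he⟩ := exists_surjective_nat (Iio l)
  -- The level set of rank `θ` is exhausted by closed sets kept at distance `1 / (n + 1)` from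
  -- higher ranks. The extended distance is infinite when no higher rank occurs.
  let K : Ordinal.{0} → ℕ → Set X := fun θ n =>
    {x | θ ≤ r x} ∩ {x | ((n : ENNReal) + 1)⁻¹ ≤ Metric.infEDist x {y | θ + 1 ≤ r y}}
  have hK : ∀ θ n, IsClosed (K θ n) := fun θ n =>
    (hr θ).inter (isClosed_le continuous_const Metric.continuous_infEDist)
  have hKr : ∀ θ n, ∀ x ∈ K θ n, r x = θ := by
    intro θ n x hx
    refine le_antisymm (not_lt.1 fun hlt => ?_) hx.1
    have h1 := hx.2
    rw [mem_ofPred_eq, Metric.infEDist_zero_of_mem (show x ∈ {y | θ + 1 ≤ r y} from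
      Order.add_one_le_of_lt hlt)] at h1
    simp at h1
  -- Only the first `n` ranks in the enumeration are used, so that the union stays closed; `b`
  -- selects even ranks (inside `H`) or odd ones, and Urysohn separates the two.
  let C : Prop → ℕ → Set X := fun b n =>
    ⋃ i ∈ {i | i < n ∧ ((∃ δ, (e i).1 = 2 * δ) ↔ b)}, K (e i).1 n
  have hC : ∀ b n, IsClosed (C b n) := fun b n =>
    ((finite_lt_nat n).subset fun i hi => hi.1).isClosed_biUnion fun i _ => hK _ _
  have hmem : ∀ b n x, x ∈ C b n → (x ∈ H ↔ b) := by
    intro b n x hx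
    obtain ⟨i, hi, hx⟩ := mem_iUnion₂.1 hx
    rw [hH, hKr _ _ _ hx]
    exact hi.2
  have hdisj : ∀ n, Disjoint (C True n) (C False n) := fun n =>
    disjoint_left.2 fun x h1 h2 => (hmem _ _ _ h2).1 ((hmem _ _ _ h1).2 trivial)
  choose g hg0 hg1 hg using fun n =>
    exists_continuous_zero_one_of_isClosed (hC True n) (hC False n) (hdisj n)
  refine ⟨r, fun n => g n, fun x => if x ∈ H then 0 else 1, hrl, hr, fun n => (g n).continuous, hg,
    fun x hx => if_pos hx, fun x hx => if_neg hx, fun x => ?_⟩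
  obtain ⟨i, hi⟩ := he ⟨r x, hrl x⟩
  have hpos : 0 < Metric.infEDist x {y | r x + 1 ≤ r y} := by
    refine pos_iff_ne_zero.2 fun h => ?_
    have := (hr (r x + 1)).closure_eq ▸ Metric.mem_closure_iff_infEDist_zero.2 h
    exact absurd (show r x + 1 ≤ r x from this) (not_le.2 (Order.lt_add_one_iff.2 le_rfl))
  obtain ⟨k, hk⟩ := ENNReal.exists_inv_nat_lt hpos.ne'
  refine eventually_atTop.2 ⟨max k (i + 1), fun N hN => ?_⟩
  filter_upwards [Metric.continuous_infEDist.continuousAt.eventually_const_lt hk]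
    with y hy hry n hn
  have hyC : y ∈ C (y ∈ H) n := by
    refine mem_iUnion₂.2 ⟨i, ⟨?_, ?_⟩, ?_⟩
    · have := (le_max_right k (i + 1)).trans (hN.trans hn)
      omega
    · rw [hH, hry, hi]
    · rw [hi]
      refine ⟨hry.ge, le_trans ?_ hy.le⟩
      refine ENNReal.inv_le_inv.2 ?_
      have : k ≤ n + 1 := ((le_max_left k (i + 1)).trans (hN.trans hn)).trans (Nat.le_succ n)
      exact_mod_cast this
  have hxy : y ∈ H ↔ x ∈ H := by rw [hH, hH, hry]
  by_cases hx : x ∈ H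
  · rw [if_pos hx]
    rw [eq_true (hxy.2 hx)] at hyC
    exact hg0 n hyC
  · rw [if_neg hx]
    rw [eq_false (fun h => hx (hxy.1 h))] at hyC
    exact hg1 n hyC

/-- The iterates of the separation derivative give a transfinite difference. -/
theorem isTransfiniteDiff_of_iterDeriv {τ τ' : TopologicalSpace X} {A B : Set X}
    (hP : ∀ F, IsClosed[τ'] F → PiZero τ ξ F) (h : iterDeriv (sepDeriv τ' A B) l = ∅) :
    ∃ H, IsTransfiniteDiff τ ξ (2 * l) H ∧ A ⊆ H ∧ H ⊆ Bᶜ := by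
  classical
  let P := iterDeriv (sepDeriv τ' A B)
  have hPc : ∀ δ, IsClosed[τ'] (P δ) := @isClosed_iterDeriv_sepDeriv X τ' A B
  have hPa : Antitone P := antitone_iterDeriv fun δ => @sepDeriv_subset_self X τ' _ A B (hPc δ)
  have hPs : ∀ δ, P (δ + 1) = sepDeriv τ' A B (P δ) := iterDeriv_add_one
  -- Even stages are the iterates and odd stages `cl (P δ ∩ B)`. Thus `G (2δ) \ G (2δ+1)` misses
  -- `B`, while `G (2δ+1) \ G (2δ+2)` misses `A`.
  let G : Ordinal.{0} → Set X := fun θ =>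
    if θ % 2 = 0 then P (θ / 2) else @closure X τ' (P (θ / 2) ∩ B)
  have two : (2 : Ordinal.{0}) ≠ 0 := two_ne_zero
  have hG0 : ∀ δ, G (2 * δ) = P δ := fun δ => by
    simp [G, Ordinal.mul_div_cancel _ two]
  have hG1 : ∀ δ, G (2 * δ + 1) = @closure X τ' (P δ ∩ B) := fun δ => by
    simp [G, Ordinal.mul_add_div _ two, Ordinal.mul_add_mod_self, Ordinal.div_eq_zero_of_lt,
      Ordinal.mod_eq_of_lt]
  have hG2 : ∀ δ, (2 : Ordinal.{0}) * δ + 1 + 1 = 2 * (δ + 1) := fun δ => by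
    rw [mul_add_one, add_assoc, one_add_one_eq_two]
  have hcases : ∀ θ : Ordinal.{0}, ∃ δ, θ = 2 * δ ∨ θ = 2 * δ + 1 := by
    intro θ
    refine ⟨θ / 2, ?_⟩
    have h1 := Ordinal.div_add_mod θ 2
    have h2 : θ % 2 < 1 + 1 := by rw [one_add_one_eq_two]; exact Ordinal.mod_lt θ two
    rcases (Order.lt_add_one_iff.1 h2).lt_or_eq with h | h
    · rw [Order.lt_one_iff.1 h, add_zero] at h1
      exact Or.inl h1.symm
    · rw [h] at h1
      exact Or.inr h1.symm
  have hsub : ∀ δ, P (δ + 1) ⊆ G (2 * δ) ∧ P (δ + 1) ⊆ G (2 * δ + 1) := fun δ =>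
    ⟨by rw [hG0]; exact hPa le_self_add, by rw [hG1, hPs]; exact inter_subset_right⟩
  have hmul : ∀ {a b : Ordinal.{0}}, 2 * a < 2 * b → a < b := fun {a b} h =>
    lt_of_mul_lt_mul_left' h
  have hlim : ∀ θ, Order.IsSuccLimit θ → G θ = ⋂ θ' : Iio θ, G θ'.1 := by
    intro θ hθ
    obtain ⟨δ, rfl | rfl⟩ := hcases θ
    · have hδ : Order.IsSuccLimit δ := by
        rcases Ordinal.zero_or_succ_or_isSuccLimit δ with rfl | ⟨ρ, rfl⟩ | h
        · simp at hθ
        · rw [Order.succ_eq_add_one, ← hG2] at hθ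
          exact absurd hθ (Order.not_isSuccLimit_add_one _)
        · exact h
      rw [hG0]
      refine Subset.antisymm (subset_iInter ?_) ?_
      · rintro ⟨θ', hθ'⟩
        obtain ⟨δ', rfl | rfl⟩ := hcases θ'
        · exact (hPa (hδ.add_one_lt (hmul hθ')).le).trans (hsub δ').1
        · exact (hPa (hδ.add_one_lt (hmul (le_self_add.trans_lt hθ'))).le).trans (hsub δ').2
      · rw [show P δ = ⋂ δ' : Iio δ, P δ'.1 from iterDeriv_limit hδ]
        refine subset_iInter fun δ' => ?_
        rw [← hG0]
        exact iInter_subset (fun θ' : Iio (2 * δ) => G θ'.1)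
          ⟨2 * δ'.1, mem_Iio.2 (mul_lt_mul_of_pos_left (mem_Iio.1 δ'.2) two_pos)⟩
    · exact absurd hθ (Order.not_isSuccLimit_add_one _)
  have hGs : ∀ θ, G (θ + 1) ⊆ G θ := by
    intro θ
    obtain ⟨δ, rfl | rfl⟩ := hcases θ
    · rw [hG0, hG1]
      exact @closure_minimal X τ' _ _ inter_subset_left (hPc δ)
    · rw [hG2, hG0]
      exact (hsub δ).2
  have hGa : Antitone G := antitone_of_continuous hGs hlim
  have hG00 : G 0 = univ := by
    have := hG0 0
    rw [mul_zero] at this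
    rw [this]
    exact iterDeriv_zero
  have hGl : G (2 * l) = ∅ := by rw [hG0]; exact h
  have hGc : ∀ θ, IsClosed[τ'] (G θ) := by
    intro θ
    obtain ⟨δ, rfl | rfl⟩ := hcases θ
    · rw [hG0]; exact hPc δ
    · rw [hG1]; exact @isClosed_closure X τ' _
  obtain ⟨r, hr⟩ := exists_rank hG00 hGa hGl hlim
  refine ⟨_, ⟨G, hG00, hGa, fun θ _ => hP _ (hGc θ),
    fun θ hθ => subset_empty_iff.1 (hGl ▸ hGa hθ), hlim, rfl⟩, fun x hx => ?_, ?_⟩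
  · have hrx : x ∈ G (r x) := (hr x _).2 le_rfl
    have hrx' : x ∉ G (r x + 1) := fun h =>
      ((hr x _).1 h).not_gt (Order.lt_add_one_iff.2 le_rfl)
    obtain ⟨δ, hδ | hδ⟩ := hcases (r x)
    · refine mem_iUnion₂.2 ⟨r x, ?_, mem_iUnion.2 ⟨⟨δ, hδ⟩, hrx, hrx'⟩⟩
      by_contra! hle
      have := (hr x _).2 hle
      rw [hGl] at this
      exact this
    · rw [hδ, hG2, hG0, hPs] at hrx'
      have hxP : x ∈ P δ := by
        rw [← hG0]
        exact (hr x _).2 (hδ ▸ le_self_add)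
      rw [hδ, hG1] at hrx
      exact absurd ⟨@subset_closure X τ' _ _ ⟨hxP, hx⟩, hrx⟩ hrx'
  · intro x hx hxB
    obtain ⟨η, -, hx⟩ := mem_iUnion₂.1 hx
    obtain ⟨⟨δ, rfl⟩, hx⟩ := mem_iUnion.1 hx
    rw [hG0, hG1] at hx
    exact hx.2 (@subset_closure X τ' _ _ ⟨hx.1, hxB⟩)

end differences

/-! ### Trisection -/

/-- The point of `[a, a + L]` found after `k` steps by passing from an interval to its first or
last two thirds, with weights `1 - c p q` and `c p q` where `p` and `q` are the points of
trisection. -/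
noncomputable def trisect (c : ℚ → ℚ → ℝ) : ℕ → ℚ → ℚ → ℝ
  | 0, a, _ => a
  | k + 1, a, L => (1 - c (a + L / 3) (a + 2 * L / 3)) * trisect c k a (2 * L / 3) +
      c (a + L / 3) (a + 2 * L / 3) * trisect c k (a + L / 3) (2 * L / 3)

section trisect

variable {c : ℚ → ℚ → ℝ}

theorem abs_convex_le {t x y z d : ℝ} (ht : t ∈ Icc (0 : ℝ) 1) (hx : |x| ≤ d) (hy : |y| ≤ d)
    (hz : z = (1 - t) * x + t * y) : |z| ≤ d := by
  obtain ⟨h0, h1⟩ := ht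
  rw [hz, abs_le]
  rw [abs_le] at hx hy
  constructor <;> nlinarith

theorem trisect_mem (hc : ∀ p q, c p q ∈ Icc (0 : ℝ) 1) (k : ℕ) (a L : ℚ) (hL : 0 ≤ L) :
    trisect c k a L ∈ Icc (a : ℝ) (a + L) := by
  have hL' : (0 : ℝ) ≤ L := by exact_mod_cast hL
  induction k generalizing a L with
  | zero => exact ⟨le_rfl, by simpa [trisect] using hL⟩
  | succ k ih =>
    obtain ⟨h0, h1⟩ := hc (a + L / 3) (a + 2 * L / 3)
    have h2L : (0 : ℝ) ≤ ((2 * L / 3 : ℚ) : ℝ) := by push_cast; positivity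
    obtain ⟨i1, i2⟩ := ih a (2 * L / 3) (by positivity) h2L
    obtain ⟨j1, j2⟩ := ih (a + L / 3) (2 * L / 3) (by positivity) h2L
    push_cast at i1 i2 j1 j2
    rw [trisect]
    constructor <;> nlinarith

/-- Both depths use the same weights for the first `k` steps; afterwards everything happens inside
intervals of length `(2 / 3) ^ k * L`. -/
theorem abs_trisect_sub_trisect_le (hc : ∀ p q, c p q ∈ Icc (0 : ℝ) 1) (k m : ℕ) (a L : ℚ)
    (hL : 0 ≤ L) : |trisect c (k + m) a L - trisect c k a L| ≤ (2 / 3) ^ k * L := by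
  induction k generalizing a L with
  | zero =>
    obtain ⟨h0, h1⟩ := trisect_mem hc (0 + m) a L hL
    rw [abs_le, pow_zero, one_mul, trisect]
    have hL' : (0 : ℝ) ≤ L := by exact_mod_cast hL
    constructor <;> linarith
  | succ k ih =>
    have i1 := ih a (2 * L / 3) (by positivity)
    have i2 := ih (a + L / 3) (2 * L / 3) (by positivity)
    refine (abs_convex_le (hc (a + L / 3) (a + 2 * L / 3)) i1 i2 ?_).trans_eq ?_
    · rw [Nat.add_right_comm, trisect, trisect]
      ring
    · push_cast
      ring

/-- The two candidate intervals overlap in the middle third, so a 0-1 choice that merely separates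
`y ≤ p` from `y ≥ q` always keeps `y` in the chosen interval. -/
theorem abs_trisect_sub_le {y : ℝ} (hc : ∀ p q : ℚ, p < q → (c p q = 0 ∧ y < q) ∨ (c p q = 1 ∧ p < y))
    (k : ℕ) (a L : ℚ) (hL : 0 < L) (hy : y ∈ Icc (a : ℝ) (a + L)) :
    |trisect c k a L - y| ≤ (2 / 3) ^ k * L := by
  induction k generalizing a L with
  | zero =>
    obtain ⟨h0, h1⟩ := hy
    rw [abs_le, pow_zero, one_mul, trisect]
    have hL' : (0 : ℝ) ≤ L := by exact_mod_cast hL.le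
    constructor <;> linarith
  | succ k ih =>
    have hpow : ((2 : ℝ) / 3) ^ k * ((2 * L / 3 : ℚ) : ℝ) = (2 / 3) ^ (k + 1) * L := by
      push_cast
      ring
    rw [← hpow, trisect]
    rcases hc (a + L / 3) (a + 2 * L / 3) (by linarith) with ⟨h, h'⟩ | ⟨h, h'⟩
    · rw [h, sub_zero, one_mul, zero_mul, add_zero]
      refine ih a (2 * L / 3) (by positivity) ⟨hy.1, ?_⟩
      push_cast at h' ⊢
      exact h'.le
    · rw [h, sub_self, zero_mul, one_mul, zero_add]
      refine ih (a + L / 3) (2 * L / 3) (by positivity) ⟨h'.le, ?_⟩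
      push_cast
      linarith [hy.2]

theorem exists_finset_trisect_eq (k : ℕ) (a L : ℚ) (hL : 0 < L) :
    ∃ I : Finset {pq : ℚ × ℚ // pq.1 < pq.2}, ∀ c c' : ℚ → ℚ → ℝ,
      (∀ i ∈ I, c i.1.1 i.1.2 = c' i.1.1 i.1.2) → trisect c k a L = trisect c' k a L := by
  classical
  induction k generalizing a L with
  | zero => exact ⟨∅, fun _ _ _ => rfl⟩
  | succ k ih =>
    obtain ⟨I, hI⟩ := ih a (2 * L / 3) (by positivity)
    obtain ⟨J, hJ⟩ := ih (a + L / 3) (2 * L / 3) (by positivity)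
    refine ⟨insert ⟨(a + L / 3, a + 2 * L / 3), by linarith⟩ (I ∪ J), fun c c' h => ?_⟩
    rw [trisect, trisect, hI c c' fun i hi => h i (by simp [hi]),
      hJ c c' fun i hi => h i (by simp [hi]), h _ (Finset.mem_insert_self _ _)]

theorem continuous_trisect {X : Type*} [TopologicalSpace X] {c : X → ℚ → ℚ → ℝ}
    (hc : ∀ p q, Continuous fun x => c x p q) (k : ℕ) (a L : ℚ) :
    Continuous fun x => trisect (c x) k a L := by
  induction k generalizing a L with
  | zero => exact continuous_const
  | succ k ih =>
    exact ((continuous_const.sub (hc _ _)).mul (ih _ _)).add ((hc _ _).mul (ih _ _))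

end trisect

/-! ### The convergence rank is controlled by transfinite differences -/

section convergence

variable {X : Type*} [τ : TopologicalSpace X] {f : X → ℝ} {η : Ordinal.{0}}

/-- Finitely many rank functions below `ω ^ η` have a common refinement below `ω ^ η`. -/
theorem exists_common_rank {ι : Type*} {r : ι → X → Ordinal.{0}}
    (hr : ∀ i x, r i x < Ordinal.omega0 ^ η) (hc : ∀ i θ, IsClosed {x | θ ≤ r i x})
    (I : Finset ι) : ∃ R : X → Ordinal.{0}, (∀ x, R x < Ordinal.omega0 ^ η) ∧
      ∀ x, ∀ᶠ y in 𝓝 x, R y ≤ R x ∧ (R x ≤ R y → ∀ i ∈ I, r i y = r i x) := by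
  classical
  induction I using Finset.induction_on with
  | empty =>
    exact ⟨fun _ => 0, fun _ => Ordinal.opow_pos _ Ordinal.omega0_pos, fun x => by simp⟩
  | insert j I _ ih =>
    obtain ⟨R, hR, h⟩ := ih
    refine ⟨fun x => natSum (r j x) (R x), fun x => natSum_lt_opow η _ (hr j x) _ (hR x),
      fun x => ?_⟩
    have hj : ∀ᶠ y in 𝓝 x, r j y ≤ r j x := by
      filter_upwards [(hc j (r j x + 1)).isOpen_compl.mem_nhds
        (show ¬ r j x + 1 ≤ r j x from not_le.2 (Order.lt_add_one_iff.2 le_rfl))] with y hy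
      exact Order.lt_add_one_iff.1 (not_le.1 hy)
    filter_upwards [h x, hj] with y hy hjy
    refine ⟨natSum_le_natSum hjy hy.1, fun hle => ?_⟩
    obtain ⟨h1, h2⟩ := eq_and_eq_of_natSum_le hjy hy.1 hle
    exact Finset.forall_mem_insert _ _ _ |>.2 ⟨h1, hy.2 h2.ge⟩

theorem convergenceRank_le [TopologicalSpace.MetrizableSpace X] [Nonempty X]
    (hη : η < Ordinal.omega 1) (hb : ∃ M : ℝ, ∀ x, |f x| ≤ M)
    (h : ∀ p q : ℚ, p < q → ∃ l ≤ Ordinal.omega0 ^ η, ∃ H, IsTransfiniteDiff τ 1 l H ∧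
      {x | f x ≤ p} ⊆ H ∧ H ⊆ {x | q ≤ f x}ᶜ) :
    IsBaireClass τ 1 f ∧ convergenceRank τ f ≤ Ordinal.omega0 ^ η := by
  have hseq : ∀ i : {pq : ℚ × ℚ // pq.1 < pq.2},
      ∃ (r : X → Ordinal.{0}) (g : ℕ → X → ℝ) (u : X → ℝ),
      (∀ x, r x < Ordinal.omega0 ^ η) ∧ (∀ θ, IsClosed {x | θ ≤ r x}) ∧ (∀ n, Continuous (g n)) ∧
      (∀ n x, g n x ∈ Icc (0 : ℝ) 1) ∧
      (∀ x, (u x = 0 ∧ f x < i.1.2) ∨ (u x = 1 ∧ i.1.1 < f x)) ∧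
      ∀ x, ∀ᶠ N in atTop, ∀ᶠ y in 𝓝 x, r y = r x → ∀ n ≥ N, g n y = u x := by
    rintro ⟨⟨p, q⟩, hpq⟩
    obtain ⟨l, hl, H, hH, hpH, hHq⟩ := h p q hpq
    obtain ⟨r, g, u, h1, h2, h3, h4, h5, h6, h7⟩ :=
      hH.exists_seq (hl.trans_lt (opow_lt_omega_one hη))
    refine ⟨r, g, u, fun x => (h1 x).trans_le hl, h2, h3, h4, fun x => ?_, h7⟩
    by_cases hx : x ∈ H
    · exact Or.inl ⟨h5 x hx, not_le.1 (hHq hx)⟩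
    · exact Or.inr ⟨h6 x hx, not_le.1 fun hle => hx (hpH hle)⟩
  choose r g u hr hrc hgc hg hu hloc using hseq
  obtain ⟨M, hM⟩ := hb
  obtain ⟨K, hK⟩ := exists_nat_gt M
  have hKpos : (0 : ℝ) < K := ((abs_nonneg _).trans (hM (Classical.arbitrary X))).trans_lt hK
  have hLpos : (0 : ℚ) < 2 * K := by
    have : (0 : ℚ) < K := by exact_mod_cast hKpos
    positivity
  have hmem : ∀ x, f x ∈ Icc (((-K : ℚ) : ℚ) : ℝ) (((-K : ℚ) : ℚ) + ((2 * K : ℚ) : ℝ)) := by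
    intro x
    have := abs_le.1 (hM x)
    push_cast
    constructor <;> linarith
  generalize (-K : ℚ) = a at hmem
  generalize (2 * K : ℚ) = L at hmem hLpos
  -- The value `0` for `p ≥ q` is harmless: trisection of an interval of positive length only
  -- queries `p < q`.
  let c : ℕ → X → ℚ → ℚ → ℝ := fun n x p q => if hpq : p < q then g ⟨(p, q), hpq⟩ n x else 0
  let c' : X → ℚ → ℚ → ℝ := fun x p q => if hpq : p < q then u ⟨(p, q), hpq⟩ x else 0
  have hcI : ∀ n x (i : {pq : ℚ × ℚ // pq.1 < pq.2}), c n x i.1.1 i.1.2 = g i n x :=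
    fun n x i => dif_pos i.2
  have hcI' : ∀ x (i : {pq : ℚ × ℚ // pq.1 < pq.2}), c' x i.1.1 i.1.2 = u i x :=
    fun x i => dif_pos i.2
  have hc : ∀ n x p q, c n x p q ∈ Icc (0 : ℝ) 1 := by
    intro n x p q
    by_cases hpq : p < q
    · simpa only [c, dif_pos hpq] using hg _ n x
    · simp [c, hpq]
  have hc' : ∀ x (p q : ℚ), p < q → (c' x p q = 0 ∧ f x < q) ∨ (c' x p q = 1 ∧ p < f x) := by
    intro x p q hpq
    simpa only [c', dif_pos hpq] using hu ⟨(p, q), hpq⟩ x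
  have hcc : ∀ n p q, Continuous fun x => c n x p q := by
    intro n p q
    by_cases hpq : p < q
    · simpa only [c, dif_pos hpq] using hgc _ n
    · simpa only [c, dif_neg hpq] using continuous_const
  -- Depth and weights advance together; truncating at depth `k` costs a uniform `(2 / 3) ^ k * L`
  -- and leaves finitely many weights.
  let φ : ℕ → X → ℝ := fun n x => trisect (c n x) n a L
  have hφc : ∀ n, Continuous (φ n) := fun n => continuous_trisect (hcc n) n a L
  have hφ : ∀ k n x, k ≤ n → |φ n x - trisect (c n x) k a L| ≤ (2 / 3) ^ k * L := by
    intro k n x hkn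
    obtain ⟨m, rfl⟩ := Nat.exists_eq_add_of_le hkn
    exact abs_trisect_sub_trisect_le (hc _ x) k m a L hLpos.le
  have hsmall : ∀ ε : ℝ, 0 < ε → ∃ k : ℕ, 2 * ((2 / 3 : ℝ) ^ k * L) < ε := by
    intro ε hε
    have : Tendsto (fun k : ℕ => 2 * ((2 / 3 : ℝ) ^ k * L)) atTop (𝓝 (2 * (0 * L))) :=
      ((tendsto_pow_atTop_nhds_zero_of_lt_one (by norm_num) (by norm_num)).mul_const _).const_mul _
    rw [zero_mul, mul_zero] at this
    exact (this.eventually_lt_const hε).exists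
  have hlim : ∀ x, Tendsto (fun n => φ n x) atTop (𝓝 (f x)) := by
    intro x
    rw [Metric.tendsto_atTop']
    intro ε hε
    obtain ⟨k, hk⟩ := hsmall ε hε
    obtain ⟨I, hI⟩ := exists_finset_trisect_eq k a L hLpos
    obtain ⟨N, hN⟩ := ((Finset.eventually_all I).2 fun i _ => hloc i x).exists
    refine ⟨max N k, fun n hn => ?_⟩
    have h1 := hφ k n x ((le_max_right _ _).trans hn.le)
    have h2 := abs_trisect_sub_le (hc' x) k a L hLpos (hmem x)
    rw [hI (c n x) (c' x) fun i hi => by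
      rw [hcI, hcI', (hN i hi).self_of_nhds rfl n ((le_max_left _ _).trans hn.le)]] at h1
    rw [Real.dist_eq]
    calc _ ≤ _ := abs_sub_le _ (trisect (c' x) k a L) _
      _ < ε := by linarith
  have hle : convergenceRank τ f ≤
      ⨆ ε : {ε : ℝ // 0 < ε}, derivRank (seqOscDeriv τ φ ε.1) := csInf_le' ⟨φ, hφc, hlim, rfl⟩
  refine ⟨isBaireClass_one.2 ⟨φ, hφc, hlim⟩, hle.trans ?_⟩
  refine Ordinal.iSup_le fun ⟨ε, hε⟩ => derivRank_le ?_
  obtain ⟨k, hk⟩ := hsmall (ε / 2) (by positivity)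
  obtain ⟨I, hI⟩ := exists_finset_trisect_eq k a L hLpos
  obtain ⟨R, hR, hRI⟩ := exists_common_rank hr hrc I
  have key : ∀ θ, iterDeriv (seqOscDeriv τ φ ε) θ ⊆ {x | θ ≤ R x} := by
    refine iterDeriv_subset (by simp) (fun θ hθ x hx => ?_) fun θ hθ => ?_
    · have hθx : θ ≤ R x := hθ hx.1
      -- If `R x = θ`, nearby points of the iterate have `R y ≥ R x`, hence the same ranks as `x`
      -- for all pairs in `I`. The weights to depth `k` are then independent of large `n`, and `x`
      -- cannot survive the derivative.
      refine Order.add_one_le_of_lt (lt_of_le_of_ne hθx fun heq => ?_)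
      obtain ⟨N, hN⟩ := ((Finset.eventually_all I).2 fun i _ => hloc i x).exists
      obtain ⟨U, hU, hUo, hxU⟩ := eventually_nhds_iff.1
        ((hRI x).and ((Finset.eventually_all I).2 hN))
      have hle := hx.2.trans (seqOsc_le (N := max N k) (c := ε / 2) hUo hxU
        fun m hm n hn y hy => by
          obtain ⟨⟨-, h1⟩, h2⟩ := hU y hy.1
          have h3 := h1 (heq ▸ hθ hy.2)
          have hm' := hφ k m y ((le_max_right _ _).trans hm)
          have hn' := hφ k n y ((le_max_right _ _).trans hn)
          rw [hI (c m y) (c n y) fun i hi => by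
            rw [hcI, hcI, h2 i hi (h3 i hi) m ((le_max_left _ _).trans hm),
              h2 i hi (h3 i hi) n ((le_max_left _ _).trans hn)]] at hm'
          rw [abs_le] at hm' hn' ⊢
          constructor <;> linarith)
      rw [ENNReal.ofReal_le_ofReal_iff (by positivity)] at hle
      linarith
    · ext x
      simp only [mem_ofPred_eq, mem_iInter, Subtype.forall, mem_Iio]
      refine ⟨fun hx θ' hθ' => hθ'.le.trans hx, fun hx => le_of_forall_lt fun θ' hθ' => ?_⟩
      exact Order.add_one_le_iff.1 (hx _ (hθ.add_one_lt hθ'))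
  exact eq_empty_of_forall_notMem fun x hx => (hR x).not_ge (key _ hx)

end convergence

/-! ### The ranks of class `ξ` -/

section classRanks

variable {X : Type*} {τ : TopologicalSpace X} {f : X → ℝ} {ξ η : Ordinal.{0}}

theorem starRank_mono {ρ ρ' : TopologicalSpace X → (X → ℝ) → Ordinal.{0}}
    (h : ∀ τ' ∈ refinements τ ξ f, ρ τ' f ≤ ρ' τ' f) (hne : (refinements τ ξ f).Nonempty) :
    starRank ρ τ ξ f ≤ starRank ρ' τ ξ f := by
  refine le_csInf (hne.image _) ?_
  rintro _ ⟨τ', hτ', rfl⟩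
  exact (csInf_le' (mem_image_of_mem _ hτ')).trans (h τ' hτ')

theorem classSeparationRank_le (hη : 1 ≤ η) (hη' : η < Ordinal.omega 1)
    (hne : (refinements τ ξ f).Nonempty)
    (h : starRank separationRank τ ξ f ≤ Ordinal.omega0 ^ η) :
    classSeparationRank τ ξ f ≤ Ordinal.omega0 ^ η := by
  obtain ⟨τ', hτ', heq⟩ := csInf_mem (hne.image fun τ' => separationRank τ' f)
  refine Ordinal.iSup_le fun pq => csInf_le' (mem_insert_of_mem _ ?_)
  have hle : derivRank (sepDeriv τ' {x | f x ≤ (pq.1.1 : ℝ)} {x | (pq.1.2 : ℝ) ≤ f x}) ≤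
      Ordinal.omega0 ^ η := (Ordinal.le_iSup (fun pq : {pq : ℚ × ℚ // pq.1 < pq.2} =>
        derivRank (sepDeriv τ' {x | f x ≤ (pq.1.1 : ℝ)} {x | (pq.1.2 : ℝ) ≤ f x})) pq).trans
        (heq.trans_le h)
  have hempty := iterDeriv_derivRank (hle.trans_lt (opow_lt_omega_one hη'))
  have hanti := antitone_iterDeriv fun θ => @sepDeriv_subset_self X τ' _ {x | f x ≤ (pq.1.1 : ℝ)}
    {x | (pq.1.2 : ℝ) ≤ f x} (@isClosed_iterDeriv_sepDeriv X τ' _ _ θ)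
  rw [← two_mul_opow hη]
  exact isTransfiniteDiff_of_iterDeriv (τ' := τ')
    (fun F hF => hτ'.2.2.1 _ (@IsClosed.isOpen_compl X τ' F hF))
    (subset_empty_iff.1 (hempty ▸ hanti hle))

theorem starRank_convergenceRank_le [@PolishSpace X τ] [Nonempty X] (hξ : 1 ≤ ξ)
    (hη' : η < Ordinal.omega 1) (hb : ∃ M : ℝ, ∀ x, |f x| ≤ M)
    (h : classSeparationRank τ ξ f ≤ Ordinal.omega0 ^ η) :
    starRank convergenceRank τ ξ f ≤ Ordinal.omega0 ^ η := by
  have hsep : ∀ i : {pq : ℚ × ℚ // pq.1 < pq.2}, ∃ l ≤ Ordinal.omega0 ^ η, ∃ H,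
      IsTransfiniteDiff τ ξ l H ∧ {x | f x ≤ i.1.1} ⊆ H ∧ H ⊆ {x | i.1.2 ≤ f x}ᶜ := by
    intro i
    have hle := (Ordinal.le_iSup (fun pq : {pq : ℚ × ℚ // pq.1 < pq.2} =>
      sepLength τ ξ {x | f x ≤ (pq.1.1 : ℝ)} {x | (pq.1.2 : ℝ) ≤ f x}) i).trans h
    rcases csInf_mem (insert_nonempty (Ordinal.omega 1) {l | ∃ H, IsTransfiniteDiff τ ξ l H ∧
      {x | f x ≤ (i.1.1 : ℝ)} ⊆ H ∧ H ⊆ {x | (i.1.2 : ℝ) ≤ f x}ᶜ}) with h' | h'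
    · exact absurd h' (hle.trans_lt (opow_lt_omega_one hη')).ne
    · exact ⟨_, hle, h'⟩
  choose l hl H hH hp hq using hsep
  choose S hS hS' using fun i => (hH i).exists_sigmaZero ((hl i).trans_lt (opow_lt_omega_one hη'))
  have : Nonempty {pq : ℚ × ℚ // pq.1 < pq.2} := ⟨⟨(0, 1), one_pos⟩⟩
  obtain ⟨e, he⟩ := exists_surjective_nat ({pq : ℚ × ℚ // pq.1 < pq.2} × ℕ)
  obtain ⟨τ', h1, h2, h3, h4⟩ := exists_polish_isOpen hξ (fun n => S (e n).1 (e n).2)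
    fun n => hS _ _
  obtain ⟨h5, h6⟩ := @convergenceRank_le X τ' f η
    (@PolishSpace.toIsCompletelyMetrizableSpace X τ' h2).MetrizableSpace _ hη' hb
    fun p q hpq => ⟨l ⟨(p, q), hpq⟩, hl _, H ⟨(p, q), hpq⟩, hS' _ τ' fun n => by
      obtain ⟨m, hm⟩ := he (⟨(p, q), hpq⟩, n)
      have := h4 m
      rwa [hm] at this, hp ⟨(p, q), hpq⟩, hq ⟨(p, q), hpq⟩⟩
  have hle : starRank convergenceRank τ ξ f ≤ convergenceRank τ' f :=
    csInf_le' ⟨τ', ⟨h1, h2, h3, h5⟩, rfl⟩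
  exact hle.trans h6

end classRanks

end BaireRank

/-! ### Closing the cycle of inequalities -/

theorem mainTheorem8 {X : Type*} [τ : TopologicalSpace X] [PolishSpace X] [Uncountable X]
    (ξ : Ordinal.{0}) (hξ : 1 ≤ ξ) (hξ' : ξ < Ordinal.omega 1)
    (f : X → ℝ) (hf : BaireRank.IsBaireClass τ ξ f) (hb : ∃ M : ℝ, ∀ x, |f x| ≤ M) :
    -- the ranks are well defined and countable
    (BaireRank.refinements τ ξ f).Nonempty ∧
    BaireRank.starRank BaireRank.separationRank τ ξ f < Ordinal.omega 1 ∧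
    BaireRank.starRank BaireRank.oscillationRank τ ξ f < Ordinal.omega 1 ∧
    BaireRank.starRank BaireRank.convergenceRank τ ξ f < Ordinal.omega 1 ∧
    BaireRank.classSeparationRank τ ξ f < Ordinal.omega 1 ∧
    -- the ranks with a star essentially agree
    BaireRank.EssEq (BaireRank.starRank BaireRank.separationRank τ ξ f)
      (BaireRank.starRank BaireRank.oscillationRank τ ξ f) ∧
    BaireRank.EssEq (BaireRank.starRank BaireRank.oscillationRank τ ξ f)
      (BaireRank.starRank BaireRank.convergenceRank τ ξ f) ∧
    -- and they essentially agree with the separation rank of class `ξ`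
    BaireRank.EssEq (BaireRank.starRank BaireRank.separationRank τ ξ f)
      (BaireRank.classSeparationRank τ ξ f) ∧
    BaireRank.EssEq (BaireRank.starRank BaireRank.oscillationRank τ ξ f)
      (BaireRank.classSeparationRank τ ξ f) ∧
    BaireRank.EssEq (BaireRank.starRank BaireRank.convergenceRank τ ξ f)
      (BaireRank.classSeparationRank τ ξ f) := by
  have hne := BaireRank.refinements_nonempty hξ hf
  have hαβ : BaireRank.starRank BaireRank.separationRank τ ξ f ≤
      BaireRank.starRank BaireRank.oscillationRank τ ξ f :=
    BaireRank.starRank_mono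
      (fun τ' _ => @BaireRank.separationRank_le_oscillationRank X τ' f) hne
  have hβγ : BaireRank.starRank BaireRank.oscillationRank τ ξ f ≤
      BaireRank.starRank BaireRank.convergenceRank τ ξ f :=
    BaireRank.starRank_mono
      (fun τ' h => @BaireRank.oscillationRank_le_convergenceRank X τ' f h.2.2.2) hne
  have hγ : BaireRank.starRank BaireRank.convergenceRank τ ξ f < Ordinal.omega 1 := by
    obtain ⟨τ', hτ'⟩ := hne
    exact lt_of_le_of_lt (csInf_le' (mem_image_of_mem _ hτ'))
      (@BaireRank.convergenceRank_lt X τ' f hτ'.2.1 hτ'.2.2.2)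
  have hβ := hβγ.trans_lt hγ
  have hα := hαβ.trans_lt hβ
  have hcl : ∀ η : Ordinal.{0}, 1 ≤ η → η < Ordinal.omega 1 →
      BaireRank.starRank BaireRank.separationRank τ ξ f ≤ Ordinal.omega0 ^ η →
      BaireRank.classSeparationRank τ ξ f ≤ Ordinal.omega0 ^ η := fun η h1 h2 h =>
    BaireRank.classSeparationRank_le h1 h2 hne h
  have hstar : ∀ η : Ordinal.{0}, η < Ordinal.omega 1 →
      BaireRank.classSeparationRank τ ξ f ≤ Ordinal.omega0 ^ η →
      BaireRank.starRank BaireRank.convergenceRank τ ξ f ≤ Ordinal.omega0 ^ η := fun η h2 h =>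
    BaireRank.starRank_convergenceRank_le hξ h2 hb h
  have hξα : BaireRank.classSeparationRank τ ξ f < Ordinal.omega 1 := by
    -- Since `θ ≤ ω ^ θ`, the countable rank `α*` (or `1`, if larger) serves as its own exponent.
    have h1 : max 1 (BaireRank.starRank BaireRank.separationRank τ ξ f) < Ordinal.omega 1 :=
      max_lt (hξ.trans_lt hξ') hα
    exact (hcl _ (le_max_left _ _) h1 ((le_max_right _ _).trans
      (Ordinal.right_le_opow _ Ordinal.one_lt_omega0))).trans_lt (BaireRank.opow_lt_omega_one h1)
  refine ⟨hne, hα, hβ, hγ, hξα, ⟨?_, ?_⟩, ⟨?_, ?_⟩, ⟨?_, ?_⟩, ⟨?_, ?_⟩, ⟨?_, ?_⟩⟩ <;>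
    intro η h1 h2 h
  · exact hαβ.trans h
  · exact hβγ.trans (hstar η h2 (hcl η h1 h2 h))
  · exact hβγ.trans h
  · exact hstar η h2 (hcl η h1 h2 (hαβ.trans h))
  · exact hαβ.trans (hβγ.trans (hstar η h2 h))
  · exact hcl η h1 h2 h
  · exact hβγ.trans (hstar η h2 h)
  · exact hcl η h1 h2 (hαβ.trans h)
  · exact hstar η h2 h
  · exact hcl η h1 h2 (hαβ.trans (hβγ.trans h))
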